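/- **Conventions.** Let $t\ge 2$ and $n\ge 1$ be integers, $\omega\in\mathbb C$ a primitive $t$-th root of unity, $X=(x_1,\dots,x_n)$ and $y$ indeterminates, $\bar x=1/x$, $\overline X=(\bar x_1,\dots,\bar x_n)$, $X^t=(x_1^t,\dots,x_n^t)$; all identities hold in the field $\mathbb C(x_1,\dots,x_n,y)$. For a sequence $a=(a_1\ge\dots\ge a_N\ge0)$ and $b_j=a_j+N-j$, put $$s_a(z_1,\dots,z_N)=\frac{\det(z_i^{b_j})}{\det(z_i^{N-j})},\qquad \mathrm{oo}_a(z_1,\dots,z_N)=\frac{\det\big(z_i^{b_j+1}-\bar z_i^{\,b_j}\big)}{\det\big(z_i^{N-j+1}-\bar z_i^{\,N-j}\big)}\qquad(1\le i,j\le N).$$ Let $\lambda$ be a partition with $\ell(\lambda)\le tn+1$, and let $\beta_j(\lambda)=\lambda_j+(tn+1)-j$ for $1\le j\le tn+1$. For $0\le i\le t-1$ let $n_i=n_i(\lambda)$ be the number of $j$ with $\beta_j(\lambda)\equiv i\pmod t$. Let $\lambda^{(i)}$ be the partition with at most $n_i$ parts such that the numbers $\beta_j(\lambda)\equiv i \pmod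 t$ are exactly $t\big(\lambda^{(i)}_j+n_i-j\big)+i$, $1\le j\le n_i$. The $t$-core $\mathrm{core}_t(\lambda)$ is the partition $\nu$ for which $\{\nu_j+(tn+1)-j: 1\le j\le tn+1\}=\{tj+i:0\le i\le t-1,\ 0\le j<n_i\}$. Let $\sigma_\lambda\in S_{tn+1}$ be the permutation for which the sequence $j\mapsto\beta_{\sigma_\lambda(j)}(\lambda)$ lists first the $\beta$'s congruent to $0$, then those congruent to $1$, $\dots$, then those congruent to $t-1$ modulo $t$, in decreasing order within each class. A partition $\mu$ of Frobenius rank $r$ with Frobenius coordinates $(\alpha_1,\dots,\alpha_r\,|\,\beta_1,\dots,\beta_r)$ (where $\alpha_i=\mu_i-i$, $\beta_i=\mu'_i-i$) is $(z_1,z_2,k)$-asymmetric, $0\le k\le r$, if either $k=0$ and $\beta=(\alpha_1+z_1,\dots,\alpha_r+z_1)$, or $k\ge1$ and $\beta=(\alpha_1+z_1,\dots,\widehat{\alpha_k+z_1},\dots,\alpha_r+z_1,z_2)$, the hat denoting omission. **Theorem.** Suppose first that $\mathrm{core}_t(\lambda)$ is $(2,0,k)$- or $(2,1,k)$-asymmetric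 for some $0\le k\le \mathrm{rk}(\mathrm{core}_t(\lambda))$. Then there is a unique $i_0\in\{0,\dots,\lfloor\frac{t-1}2\rfloor\}$ such that, for all $0\le i\le\lfloor\frac{t-1}2\rfloor$, $$n_i+n_{t-1-i}=\begin{cases}2n+1+\delta_{i_0,\frac{t-1}2}& i=i_0,\\ 2n&i\ne i_0.\end{cases}$$ Put $$\epsilon_1(\lambda)=\sum_{i=t-i_0}^{t-1}n_i+\sum_{i=\lfloor\frac{t+1}2\rfloor}^{t-1}\Big(\tbinom{n_i+1}2+tn(n_i-n)\Big),$$ $$\pi_i=\lambda^{(t-1-i)}_1+\big(\lambda^{(i)},0,\dots,0,-\mathrm{rev}(\lambda^{(t-1-i)})\big),$$ where the sequence $\pi_i$ has $2n+\delta_{i,i_0}$ parts, $\mathrm{rev}$ reverses a sequence and the constant is added to every part, and $$\mu_{i_0}=t\big(\lambda^{(t-1-i_0)}_1+n_{t-1-i_0}-n\big)-i_0 .$$ 1. If $i_0=\frac{t-1}2$, then $$\mathrm{oo}_\lambda(X,\omega X,\dots,\omega^{t-1}X,y)=(-1)^{\epsilon_1(\lambda)}\,\mathrm{sgn}(\sigma_\lambda)\;\mathrm{oo}_{(\frac{t-1}2)}(y)\;\mathrm{oo}_{\lambda^{(\frac{t-1}2)}}(X^t,y^t)\prod_{i=0}^{\frac{t-3}2}s_{\pi_i}(X^t,\overline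 X^t).$$ 2. If $i_0\ne\frac{t-1}2$, then $$\mathrm{oo}_\lambda(X,\omega X,\dots,\omega^{t-1}X,y)=\mathrm{sgn}(\sigma_\lambda)(-1)^{\epsilon_1(\lambda)}\,\frac{y^{-\mu_{i_0}+1}s_{\pi_{i_0}}(X^t,\overline X^t,y^t)-y^{\mu_{i_0}}s_{\pi_{i_0}}(X^t,\overline X^t,\bar y^t)}{y-1}\prod_{\substack{0\le i\le\lfloor\frac{t-2}2\rfloor\\ i\ne i_0}}s_{\pi_i}(X^t,\overline X^t)\cdot\begin{cases}\mathrm{oo}_{\lambda^{(\frac{t-1}2)}}(X^t)&t\text{ odd},\\1&t\text{ even}.\end{cases}$$ 3. If $\mathrm{core}_t(\lambda)$ is neither $(2,0,k)$- nor $(2,1,k)$-asymmetric for any $0\le k\le\mathrm{rk}(\mathrm{core}_t(\lambda))$, then $$\mathrm{oo}_\lambda(X,\omega X,\dots,\omega^{t-1}X,y)=0.$$ -/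

import Mathlib

namespace OddOrthFactor

noncomputable section

/-! Partitions are Young diagrams: `μ.rowLen i` is the part `μ_{i+1}`, `μ.colLen i` is the part
`μ'_{i+1}` of the conjugate partition, and `μ.colLen 0` is the length of `μ`. All indices of parts
are zero-based. -/

/-! ### Beta-sets, cores and quotients -/

/-- The beta-numbers of `μ` as a strictly decreasing `ℓ`-tuple: part plus `ℓ` minus (one-based)
index. -/
def beta (μ : YoungDiagram) (ℓ : ℕ) (j : Fin ℓ) : ℕ := μ.rowLen j + (ℓ - 1 - j)

/-- The beta-numbers as a finite set. -/
def betaSet (μ : YoungDiagram) (ℓ : ℕ) : Finset ℕ := Finset.univ.image (beta μ ℓ)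

/-- The number `n_i(μ, ℓ)` of beta-numbers that are congruent to `i` modulo `t`. -/
def resCount (μ : YoungDiagram) (t ℓ i : ℕ) : ℕ := ((betaSet μ ℓ).filter (fun b => b % t = i)).card

theorem sub_index_mono {k : ℕ} (f : Fin k → ℕ) (hf : StrictMono f) :
    Monotone (fun i : Fin k => f i - (i : ℕ)) := by
  have key : ∀ d : ℕ, ∀ i j : Fin k, (j : ℕ) = i + d → f i + d ≤ f j := by
    intro d
    induction d with
    | zero =>
      intro i j h
      have : i = j := Fin.ext (by omega)
      subst this
      simp
    | succ d ih =>
      intro i j h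
      have hj : (i : ℕ) + d < k := by have := j.isLt; omega
      have h1 := ih i ⟨i + d, hj⟩ rfl
      have h2 : f ⟨i + d, hj⟩ < f j := hf (by rw [Fin.lt_def]; simp; omega)
      omega
  intro i j hij
  have hij' : (i : ℕ) ≤ j := hij
  have := key (j - i) i j (by omega)
  show f i - (i : ℕ) ≤ f j - (j : ℕ)
  omega

/-- The partition whose beta-set (for `ℓ = #B`) is `B`: if `b_1 > ⋯ > b_ℓ` are the elements
of `B`, its parts are `b_i - ℓ + i`. -/
def ofBetaSet (B : Finset ℕ) : YoungDiagram :=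
  YoungDiagram.ofRowLens
    (List.ofFn fun i : Fin B.card => B.orderEmbOfFin rfl i.rev - (i.rev : ℕ))
    (by
      apply List.sortedGE_ofFn_iff.2
      intro i j hij
      exact sub_index_mono _ (B.orderEmbOfFin rfl).strictMono (Fin.rev_le_rev.2 hij))

/-- The `t`-core of `μ`, read off from its `ℓ` beta-numbers: its beta-set consists of the `ℓ`
numbers `t j + i` with `0 ≤ i < t` and `0 ≤ j < n_i(μ, ℓ)`. -/
def core (μ : YoungDiagram) (t ℓ : ℕ) : YoungDiagram :=
  ofBetaSet ((Finset.range t).biUnion fun i =>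
    (Finset.range (resCount μ t ℓ i)).image fun j => t * j + i)

/-- The component `μ^{(i)}` of the `t`-quotient of `μ`, read off from its `ℓ` beta-numbers: the
beta-numbers of `μ` congruent to `i` are `t b + i`, where `b` runs over the beta-set of `μ^{(i)}`. -/
def quo (μ : YoungDiagram) (t ℓ i : ℕ) : YoungDiagram :=
  ofBetaSet (((betaSet μ ℓ).filter (fun b => b % t = i)).image (fun b => b / t))

/-- The permutation `σ_μ` of the `ℓ` positions for which `j ↦ β_{σ(j)}(μ)` lists first the
beta-numbers congruent to `0` modulo `t`, then those congruent to `1`, and so on, those in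
the same class in decreasing order. -/
def sortPerm (μ : YoungDiagram) (t ℓ : ℕ) : Equiv.Perm (Fin ℓ) :=
  Tuple.sort fun j => toLex (beta μ ℓ j % t, OrderDual.toDual (beta μ ℓ j))

/-! ### Frobenius coordinates and asymmetric partitions -/

/-- The Frobenius rank: the number of diagonal boxes, i.e. the largest `j` such that the `j`-th part
is at least `j`. -/
def rank (μ : YoungDiagram) : ℕ := (μ.cells.filter fun c => c.1 = c.2).card

/-- The Frobenius coordinates `α_1, …, α_r` (arms of the diagonal boxes). -/
def arms (μ : YoungDiagram) : List ℕ := (List.range (rank μ)).map fun i => μ.rowLen i - (i + 1)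

/-- The Frobenius coordinates `β_1, …, β_r` (legs of the diagonal boxes). -/
def legs (μ : YoungDiagram) : List ℕ := (List.range (rank μ)).map fun i => μ.colLen i - (i + 1)

/-- `μ` is `(z₁, z₂, k)`-asymmetric (used for `z₂ < z₁`): in Frobenius coordinates it is
`(α_1, …, α_r | α_1 + z₁, …, α_r + z₁)` if `k = 0`, and if `1 ≤ k ≤ r` the list of legs is obtained
from `α_1 + z₁, …, α_r + z₁` by omitting `α_k + z₁` and appending `z₂` at the end. -/
def IsAsymmetric (z₁ z₂ k : ℕ) (μ : YoungDiagram) : Prop :=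
  k ≤ rank μ ∧
    legs μ = if k = 0 then (arms μ).map (· + z₁)
      else ((arms μ).map (· + z₁)).eraseIdx (k - 1) ++ [z₂]

/-! ### Characters -/

/-- The Schur polynomial of a partition with parts `a` in as many variables `x`. -/
def schur {K : Type*} [Field K] {N : ℕ} (a : Fin N → ℕ) (x : Fin N → K) : K :=
  (Matrix.of fun i j : Fin N => x i ^ (a j + (N - 1 - j))).det /
    (Matrix.of fun i j : Fin N => x i ^ (N - 1 - (j : ℕ))).det

/-- The odd orthogonal character of a partition with parts `a` in as many variables `x`. -/
def oo {K : Type*} [Field K] {N : ℕ} (a : Fin N → ℕ) (x : Fin N → K) : K :=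
  (Matrix.of fun i j : Fin N =>
      x i ^ (a j + (N - 1 - j) + 1) - (x i)⁻¹ ^ (a j + (N - 1 - j))).det /
    (Matrix.of fun i j : Fin N => x i ^ (N - 1 - (j : ℕ) + 1) - (x i)⁻¹ ^ (N - 1 - (j : ℕ))).det

/-- The first `N` parts of a partition. -/
def parts (μ : YoungDiagram) (N : ℕ) : Fin N → ℕ := fun j => μ.rowLen j

/-- The `N` parts of `ν_1 + (μ, 0, …, 0, -rev ν)`, for `ℓ(μ) + ℓ(ν) ≤ N`. -/
def glue (μ ν : YoungDiagram) (N : ℕ) : Fin N → ℕ :=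
  fun j => ν.rowLen 0 + μ.rowLen j - ν.rowLen (N - 1 - j)

/-! ### Indeterminates -/

/-- The field of rational functions over `ℂ` in the indeterminates `x_1, …, x_n, y`. -/
abbrev RatFunField (n : ℕ) : Type := FractionRing (MvPolynomial (Option (Fin n)) ℂ)

/-- The indeterminate `x_{i+1}`. -/
def xvar {n : ℕ} (i : Fin n) : RatFunField n := algebraMap _ _ (MvPolynomial.X (R := ℂ) (some i))

/-- The indeterminate `y`. -/
def yvar (n : ℕ) : RatFunField n :=
  algebraMap _ _ (MvPolynomial.X (R := ℂ) (none : Option (Fin n)))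

/-- The `tn + 1` variables `X, ωX, …, ω^{t-1}X, y`. -/
def twisted (t n : ℕ) (ω : ℂ) : Fin (t * n + 1) → RatFunField n :=
  Fin.snoc (α := fun _ => RatFunField n)
    (fun j => algebraMap ℂ (RatFunField n) ω ^ ((finProdFinEquiv.symm j).1 : ℕ) *
      xvar (finProdFinEquiv.symm j).2)
    (yvar n)

/-- The `n` variables `X^t`. -/
def Xt (t n : ℕ) : Fin n → RatFunField n := fun i => xvar i ^ t

/-- The `2n` variables `X^t, X̄^t`, where `X̄ = (1/x_1, …, 1/x_n)`. -/
def XXt (t n : ℕ) : Fin (n + n) → RatFunField n :=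
  Fin.append (fun i => xvar i ^ t) (fun i => (xvar i)⁻¹ ^ t)

/-- Append one more variable. -/
def adjoinVar {n N : ℕ} (x : Fin N → RatFunField n) (z : RatFunField n) :
    Fin (N + 1) → RatFunField n :=
  Fin.snoc (α := fun _ => RatFunField n) x z

/-! ### The data attached to a partition of length at most `tn + 1` -/

/-- The condition that singles out the index `i₀ ∈ [0, ⌊(t-1)/2⌋]`, with `ℓ = tn + 1`. -/
def IsMiddle (μ : YoungDiagram) (t n i₀ : ℕ) : Prop :=
  i₀ ≤ (t - 1) / 2 ∧
    ∀ i ≤ (t - 1) / 2,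
      resCount μ t (t * n + 1) i + resCount μ t (t * n + 1) (t - 1 - i) =
        2 * n + (if i = i₀ then 1 + (if 2 * i₀ + 1 = t then 1 else 0) else 0)

/-- The exponent `ε₁(μ)` of the sign. -/
def eps (μ : YoungDiagram) (t n i₀ : ℕ) : ℤ :=
  (∑ i ∈ Finset.Icc (t - i₀) (t - 1), (resCount μ t (t * n + 1) i : ℤ)) +
    ∑ i ∈ Finset.Icc ((t + 1) / 2) (t - 1),
      (((resCount μ t (t * n + 1) i + 1).choose 2 : ℤ) +
        (t : ℤ) * n * ((resCount μ t (t * n + 1) i : ℤ) - n))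

/-- The `N` parts of `π_i = μ^{(t-1-i)}_1 + (μ^{(i)}, 0, …, 0, -rev μ^{(t-1-i)})`. -/
def piParts (μ : YoungDiagram) (t n i N : ℕ) : Fin N → ℕ :=
  glue (quo μ t (t * n + 1) i) (quo μ t (t * n + 1) (t - 1 - i)) N

/-- The exponent `t (μ^{(t-1-i₀)}_1 + n_{t-1-i₀}(μ) - n) - i₀`. -/
def muExp (μ : YoungDiagram) (t n i₀ : ℕ) : ℤ :=
  (t : ℤ) * (((quo μ t (t * n + 1) (t - 1 - i₀)).rowLen 0 : ℤ) +
    (resCount μ t (t * n + 1) (t - 1 - i₀) : ℤ) - n) - i₀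

end

end OddOrthFactor

open OddOrthFactor

/-! Since ω^t = 1, the entry (ω^a x)^(β+1) - (ω^a x)^(-β) involves a only through the characters a ↦
ω^(a(i+1)) with i = β mod t and with i = t-1-(β mod t). So the matrix of each determinant is a fixed
invertible matrix (a Fourier matrix tensored with the identity, and a 1 for y) times the matrix of
`sepKernel`, whose n rows of residue i live only on columns of residue i or t-1-i
(`twistMatrix_mul`). The Fourier determinant cancels in the quotient.

Sorting the columns by residue costs sgn σ_λ and leaves nested blocks, one per pair {i, t-1-i},
together with one full row for y. If a pair has too few columns the determinant vanishes
(`det_sepKernel_eq_zero`). Otherwise counting forces a single surplus column, in the pair of i₀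
(`exists_isMiddle`), and peeling pairs from the outside gives a product in which y joins the block
of i₀ (`ldet_inner_middle_eq`, `ldet_inner_middle_ne`). Reversing one class turns a pair block into
a Schur numerator in X^t and its inverses (`ldet_pairBlock`); with the row y, linearity gives a
difference of two (`ldet_pairBlock_last`). The self-paired residue gives an odd orthogonal numerator
(`ldet_midBlock`).

The denominator is the numerator of the empty partition, where i₀ = 0 and every character is 1, so
the same evaluation applies once the sorting sign is known (`ldet_beta_bot`). The constants then
cancel; if i₀ = (t-1)/2 this also needs a comparison of product formulas for the denominators
(`ooDen_snoc_mul`).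

For the core condition, put ℓ = tn+1 and let B be the beta-set of the core. Arms are the a with a+ℓ
in B, legs the g < ℓ with ℓ-1-g not in B. The reflection c ↦ 2tn-1-c exchanges residues i and t-1-i
and takes the gap of a leg g ≥ 2 to the position of an arm g-2. That n_i + n_{t-1-i} ≥ 2n for all i
means that c and its reflection are never both gaps: every leg g ≥ 2 is an arm plus 2, and 0 and 1
are not both legs. This is asymmetry (`exists_isAsymmetric_core_iff`). -/

namespace OddOrthFactor

/-! ### Determinants with rows and columns indexed by lists -/

section ListDet

variable {K ρ κ : Type*} [Field K]

/-- The determinant of the matrix with rows indexed by the list `R` and columns by the list `C`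
(zero if the lengths differ). -/
noncomputable def ldet (f : ρ → κ → K) (R : List ρ) (C : List κ) : K :=
  if h : C.length = R.length then
    (Matrix.of fun i j : Fin R.length => f (R.get i) (C.get (j.cast h.symm))).det
  else 0

theorem ldet_eq_det (f : ρ → κ → K) {N : ℕ} (R : List ρ) (C : List κ) (hR : R.length = N)
    (hC : C.length = N) :
    ldet f R C =
      (Matrix.of fun i j : Fin N => f (R.get (i.cast hR.symm)) (C.get (j.cast hC.symm))).det := by
  subst hR
  simp [ldet, hC]

theorem ldet_ofFn (f : ρ → κ → K) {N : ℕ} (R : Fin N → ρ) (C : Fin N → κ) :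
    ldet f (List.ofFn R) (List.ofFn C) = (Matrix.of fun i j : Fin N => f (R i) (C j)).det := by
  rw [ldet_eq_det f _ _ (List.length_ofFn) (List.length_ofFn)]
  simp

theorem ldet_ofFn_comp_perm (f : ρ → κ → K) {N : ℕ} (R : List ρ) (C : Fin N → κ)
    (σ : Equiv.Perm (Fin N)) :
    ldet f R (List.ofFn C) =
      ((Equiv.Perm.sign σ : ℤ) : K) * ldet f R (List.ofFn (C ∘ σ)) := by
  by_cases h : R.length = N
  · rw [ldet_eq_det f _ _ h (List.length_ofFn), ldet_eq_det f _ _ h (List.length_ofFn)]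
    have := Matrix.det_permute' σ
      (Matrix.of fun i j : Fin N => f (R.get (i.cast h.symm)) (C j))
    have h2 : ((Equiv.Perm.sign σ : ℤ) : K) * ((Equiv.Perm.sign σ : ℤ) : K) = 1 := by
      rw [← Int.cast_mul]; norm_cast; simp
    simp only [List.get_ofFn]
    simp only [Fin.cast_cast, Fin.cast_eq_self, Function.comp_apply]
    change _ = _ * Matrix.det ((Matrix.of fun i j : Fin N =>
      f (R.get (i.cast h.symm)) (C j)).submatrix id σ)
    rw [this, ← mul_assoc, h2, one_mul]
  · have h' : ¬ N = R.length := fun e => h e.symm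
    simp [ldet, h']

/-- When the lengths differ both sides are the default value 0, so this rule and the sign rules
derived from it need no length hypothesis. -/
theorem ldet_swap_adjacent (f : ρ → κ → K) (R : List ρ) (A B : List κ) (a b : κ) :
    ldet f R (A ++ a :: b :: B) = - ldet f R (A ++ b :: a :: B) := by
  set l := A ++ a :: b :: B with hl
  have h1 : A.length < l.length := by simp [hl]
  have h2 : A.length + 1 < l.length := by simp [hl]
  have key : A ++ b :: a :: B = List.ofFn (l.get ∘ Equiv.swap ⟨A.length, h1⟩ ⟨A.length + 1, h2⟩) := by
    apply List.ext_getElem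
    · simp only [hl, List.length_append, List.length_cons, List.length_ofFn]
    · intro k hk hk'
      rw [List.getElem_ofFn]
      have hkl : k < l.length := by simpa using hk'
      simp only [Function.comp_apply, List.get_eq_getElem]
      rcases lt_trichotomy k A.length with hlt | heq | hgt
      · rw [Equiv.swap_apply_of_ne_of_ne]
        · simp [hl, hlt]
        · simp [Fin.ext_iff]; omega
        · simp [Fin.ext_iff]; omega
      · subst heq
        rw [Equiv.swap_apply_left]
        simp [hl]
      · rcases Nat.lt_or_ge (A.length + 1) k with h | h
        · rw [Equiv.swap_apply_of_ne_of_ne]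
          · obtain ⟨d, rfl⟩ := Nat.exists_eq_add_of_lt h
            have e : A.length + 1 + d + 1 - A.length = d + 2 := by omega
            simp only [hl, List.getElem_append]
            rw [dif_neg (by omega), dif_neg (by omega)]
            simp [e]
          · simp [Fin.ext_iff]; omega
          · simp [Fin.ext_iff]; omega
        · obtain rfl : k = A.length + 1 := by omega
          rw [Equiv.swap_apply_right]
          simp [hl]
  rw [key]
  have := ldet_ofFn_comp_perm f R l.get (Equiv.swap ⟨A.length, h1⟩ ⟨A.length + 1, h2⟩)
  rw [List.ofFn_get] at this
  rw [this, Equiv.Perm.sign_swap (by simp [Fin.ext_iff])]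
  simp

theorem ldet_move_one (f : ρ → κ → K) (R : List ρ) (A B D : List κ) (a : κ) :
    ldet f R (A ++ a :: (B ++ D)) = (-1) ^ B.length * ldet f R (A ++ (B ++ a :: D)) := by
  induction B generalizing A with
  | nil => simp
  | cons b B ih =>
    have := ih (A ++ [b])
    simp only [List.append_assoc, List.cons_append, List.nil_append] at this ⊢
    rw [ldet_swap_adjacent, List.length_cons, pow_succ, this]
    simp

theorem ldet_move (f : ρ → κ → K) (R : List ρ) (A B C D : List κ) :
    ldet f R (A ++ (B ++ (C ++ D))) =
      (-1) ^ (B.length * C.length) * ldet f R (A ++ (C ++ (B ++ D))) := by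
  induction B generalizing A with
  | nil => simp
  | cons b B ih =>
    have h := ih (A ++ [b])
    simp only [List.append_assoc, List.cons_append, List.nil_append] at h ⊢
    rw [h, ldet_move_one, List.length_cons, add_mul, pow_add, one_mul, mul_assoc]

/-- The head of `B` passes the m remaining entries, and C(m,2) + m = C(m+1,2). -/
theorem ldet_reverse (f : ρ → κ → K) (R : List ρ) (A B D : List κ) :
    ldet f R (A ++ (B ++ D)) =
      (-1) ^ (B.length.choose 2) * ldet f R (A ++ (B.reverse ++ D)) := by
  induction B generalizing D with
  | nil => simp
  | cons b B ih =>
    have h := ih (b :: D)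
    simp only [List.cons_append, List.reverse_cons, List.append_assoc,
      List.length_cons, List.nil_append]
    rw [ldet_move_one, h, ← mul_assoc, ← pow_add, Nat.choose_succ_succ' B.length 1,
      Nat.choose_one_right]

theorem ldet_flip (f : ρ → κ → K) (R : List ρ) (C : List κ) :
    ldet f R C = ldet (fun c r => f r c) C R := by
  by_cases h : C.length = R.length
  · rw [ldet_eq_det f R C rfl h, ldet_eq_det _ C R h rfl, ← Matrix.det_transpose]
    rfl
  · rw [ldet, ldet, dif_neg h, dif_neg (Ne.symm h)]

theorem ldet_row_move (f : ρ → κ → K) (C : List κ) (A B D E : List ρ) :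
    ldet f (A ++ (B ++ (D ++ E))) C =
      (-1) ^ (B.length * D.length) * ldet f (A ++ (D ++ (B ++ E))) C := by
  rw [ldet_flip, ldet_move, ← ldet_flip]

/-- Only the upper right block has to vanish. The lower left one is arbitrary, so the full row of y
may sit in `R₂`; in the transposed version `ldet_append'` it may sit in `R₁`. -/
theorem ldet_append (f : ρ → κ → K) (R₁ R₂ : List ρ) (C₁ C₂ : List κ)
    (h₁ : C₁.length = R₁.length) (h₂ : C₂.length = R₂.length)
    (h0 : ∀ r ∈ R₁, ∀ c ∈ C₂, f r c = 0) :
    ldet f (R₁ ++ R₂) (C₁ ++ C₂) = ldet f R₁ C₁ * ldet f R₂ C₂ := by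
  rw [ldet_eq_det f (N := R₁.length + R₂.length) _ _ (by simp) (by simp [h₁, h₂]),
    ldet_eq_det f R₁ C₁ rfl h₁, ldet_eq_det f R₂ C₂ rfl h₂,
    ← Matrix.det_submatrix_equiv_self finSumFinEquiv]
  rw [← Matrix.det_fromBlocks_zero₁₂ _
    (Matrix.of fun (i : Fin R₂.length) (j : Fin R₁.length) =>
      f (R₂.get i) (C₁.get (j.cast h₁.symm)))]
  congr 1
  ext i j
  rcases i with i | i <;> rcases j with j | j
  · simp [h₁, List.getElem_append]
  · simp only [Matrix.submatrix_apply, Matrix.of_apply, Matrix.fromBlocks_apply₁₂, Matrix.zero_apply]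
    apply h0
    · simp
    · simp [h₁]
  · simp [h₁, List.getElem_append]
  · simp [h₁, List.getElem_append]

theorem ldet_append' (f : ρ → κ → K) (R₁ R₂ : List ρ) (C₁ C₂ : List κ)
    (h₁ : C₁.length = R₁.length) (h₂ : C₂.length = R₂.length)
    (h0 : ∀ r ∈ R₂, ∀ c ∈ C₁, f r c = 0) :
    ldet f (R₁ ++ R₂) (C₁ ++ C₂) = ldet f R₁ C₁ * ldet f R₂ C₂ := by
  rw [ldet_flip, ldet_append _ _ _ _ _ h₁.symm h₂.symm fun c hc r hr => h0 r hr c hc,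
    ← ldet_flip f R₁, ← ldet_flip f R₂]

end ListDet

end OddOrthFactor
namespace OddOrthFactor

/-! ### Peeling off the pairs of residues from the outside -/

section Peeling

variable {K ρ κ : Type*} [Field K]

theorem neg_one_pow_eq_of_even_add {a b : ℕ} (h : Even (a + b)) : (-1 : K) ^ a = (-1) ^ b := by
  rcases Nat.even_or_odd a with ha | ha
  · rw [ha.neg_one_pow, (Nat.even_add.1 h |>.1 ha).neg_one_pow]
  · have hb : Odd b := by
      rw [← Nat.not_even_iff_odd] at ha ⊢
      exact fun hb => ha (Nat.even_add.1 h |>.2 hb)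
    rw [ha.neg_one_pow, hb.neg_one_pow]

/-- Splitting off the outer blocks `a`, `b` when they form a square block together. -/
theorem ldet_split_outer (f : ρ → κ → K) (Sa Sm Sb U : List ρ) (Ca Cm Cb : List κ)
    (h₁ : Ca.length + Cb.length = Sa.length + Sb.length)
    (h₂ : Cm.length = Sm.length + U.length)
    (h0 : ∀ r ∈ Sa ++ Sb, ∀ c ∈ Cm, f r c = 0) :
    ldet f (Sa ++ (Sm ++ (Sb ++ U))) (Ca ++ (Cm ++ Cb)) =
      (-1) ^ (Sm.length * Sb.length + Cm.length * Cb.length) *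
        (ldet f (Sa ++ Sb) (Ca ++ Cb) * ldet f (Sm ++ U) Cm) := by
  have e := ldet_move f (Sa ++ (Sm ++ (Sb ++ U))) Ca Cm Cb []
  rw [List.append_nil, List.append_nil] at e
  rw [e, ldet_row_move, ← ldet_append f _ _ _ _ (by simpa using h₁) (by simpa using h₂) h0,
    List.append_assoc, List.append_assoc, pow_add]
  ring

/-- Splitting off the outer blocks `a`, `b` together with the full rows `U`. -/
theorem ldet_split_outer_full (f : ρ → κ → K) (Sa Sm Sb U : List ρ) (Ca Cm Cb : List κ)
    (h₁ : Ca.length + Cb.length = Sa.length + Sb.length + U.length)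
    (h₂ : Cm.length = Sm.length)
    (h0 : ∀ r ∈ Sm, ∀ c ∈ Ca ++ Cb, f r c = 0) :
    ldet f (Sa ++ (Sm ++ (Sb ++ U))) (Ca ++ (Cm ++ Cb)) =
      (-1) ^ (Sm.length * (Sb.length + U.length) + Cm.length * Cb.length) *
        (ldet f (Sa ++ (Sb ++ U)) (Ca ++ Cb) * ldet f Sm Cm) := by
  have e := ldet_move f (Sa ++ (Sm ++ (Sb ++ U))) Ca Cm Cb []
  have e' := ldet_row_move f (Ca ++ (Cb ++ Cm)) Sa Sm (Sb ++ U) []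
  rw [List.append_nil, List.append_nil] at e e'
  rw [e, e', ← ldet_append' f _ _ _ _ (by simp; omega) h₂ h0,
    List.append_assoc, List.append_assoc, List.append_assoc, List.append_assoc, pow_add,
    List.length_append]
  ring

/-- The concatenation of `C k, …, C (t - 1 - k)`. -/
def inner (C : ℕ → List κ) (t k : ℕ) : List κ := (List.range' k (t - 2 * k)).flatMap C

theorem inner_eq (C : ℕ → List κ) {t k : ℕ} (h : 2 * k + 2 ≤ t) :
    inner C t k = C k ++ (inner C t (k + 1) ++ C (t - 1 - k)) := by
  obtain ⟨m, rfl⟩ := Nat.exists_eq_add_of_le h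
  have e1 : 2 * k + 2 + m - 2 * k = (m + 1) + 1 := by omega
  have e2 : 2 * k + 2 + m - 2 * (k + 1) = m := by omega
  have e3 : 2 * k + 2 + m - 1 - k = k + 1 + m := by omega
  simp only [inner, e1, e2, e3]
  rw [List.range'_succ, List.flatMap_cons, List.range'_concat, List.flatMap_append]
  simp

theorem inner_half (C : ℕ → List κ) (t : ℕ) :
    inner C t (t / 2) = if Odd t then C (t / 2) else [] := by
  split_ifs with h
  · have e : t - 2 * (t / 2) = 1 := by obtain ⟨m, rfl⟩ := h; omega
    simp [inner, e]
  · rw [Nat.not_odd_iff_even] at h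
    have e : t - 2 * (t / 2) = 0 := by obtain ⟨m, rfl⟩ := h; omega
    simp [inner, e]

theorem mem_inner {C : ℕ → List κ} {t k : ℕ} {c : κ} (h : c ∈ inner C t k) :
    ∃ i, k ≤ i ∧ i + k < t ∧ c ∈ C i := by
  simp only [inner, List.mem_flatMap, List.mem_range'_1] at h
  obtain ⟨i, ⟨h1, h2⟩, h3⟩ := h
  exact ⟨i, h1, by omega, h3⟩

/-- Induction on the distance d from k to the centre, since each step adds one outer pair. The
remaining inductions on nested blocks follow the same pattern. -/
theorem length_inner_of_balanced (C : ℕ → List κ) (t n : ℕ) (d : ℕ) : ∀ k, k + d = t / 2 →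
    (∀ i, k ≤ i → 2 * i + 1 < t → (C i).length + (C (t - 1 - i)).length = 2 * n) →
    (∀ i, 2 * i + 1 = t → (C i).length = n) →
    (inner C t k).length = (t - 2 * k) * n := by
  induction d with
  | zero =>
    rintro k hk - hm
    obtain rfl : k = t / 2 := hk
    rw [inner_half]
    split_ifs with h
    · obtain ⟨m, rfl⟩ := h
      have e : (2 * m + 1) / 2 = m := by omega
      rw [e, hm m rfl, show 2 * m + 1 - 2 * m = 1 by omega, one_mul]
    · rw [Nat.not_odd_iff_even] at h
      obtain ⟨m, rfl⟩ := h
      rw [show m + m - 2 * ((m + m) / 2) = 0 by omega]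
      simp
  | succ d ih =>
    intro k hk hb hm
    have h1 := ih (k + 1) (by omega) (fun i hi => hb i (by omega)) hm
    have h2 := hb k le_rfl (by omega)
    rw [inner_eq C (by omega), List.length_append, List.length_append, h1]
    obtain ⟨m, rfl⟩ := Nat.exists_eq_add_of_le (show 2 * k + 2 ≤ t by omega)
    rw [show 2 * k + 2 + m - 2 * (k + 1) = m by omega,
      show 2 * k + 2 + m - 2 * k = m + 2 by omega]
    linarith

theorem length_inner_of_middle (C : ℕ → List κ) (t n i₀ : ℕ) (d : ℕ) : ∀ k, k + d = i₀ →
    2 * i₀ + 1 ≤ t →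
    (∀ i, k ≤ i → 2 * i + 1 < t → (C i).length + (C (t - 1 - i)).length =
      2 * n + if i = i₀ then 1 else 0) →
    (∀ i, 2 * i + 1 = t → (C i).length = n + if i = i₀ then 1 else 0) →
    (inner C t k).length = (t - 2 * k) * n + 1 := by
  induction d with
  | zero =>
    rintro k rfl hkt hb hm
    rw [add_zero] at *
    rcases hkt.lt_or_eq with h | h
    · have h2 := hb k le_rfl (by omega)
      rw [if_pos rfl] at h2
      rw [inner_eq C (by omega), List.length_append, List.length_append,
        length_inner_of_balanced C t n (t / 2 - (k + 1)) (k + 1) (by omega)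
        (fun i hi hit => by rw [hb i (by omega) hit, if_neg (by omega), add_zero])
        (fun i hi => by rw [hm i hi, if_neg (by omega), add_zero])]
      obtain ⟨m, rfl⟩ := Nat.exists_eq_add_of_le (show 2 * k + 2 ≤ t by omega)
      rw [show 2 * k + 2 + m - 2 * (k + 1) = m by omega,
        show 2 * k + 2 + m - 2 * k = m + 2 by omega]
      linarith
    · have := hm k h
      subst h
      rw [if_pos rfl] at this
      have e := inner_half C (2 * k + 1)
      rw [show (2 * k + 1) / 2 = k by omega, if_pos ⟨k, rfl⟩] at e
      rw [e, this, show 2 * k + 1 - 2 * k = 1 by omega, one_mul]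
  | succ d ih =>
    intro k hk hkt hb hm
    have h1 := ih (k + 1) (by omega) hkt (fun i hi => hb i (by omega)) hm
    have h2 := hb k le_rfl (by omega)
    rw [if_neg (by omega)] at h2
    rw [inner_eq C (by omega), List.length_append, List.length_append, h1]
    obtain ⟨m, rfl⟩ := Nat.exists_eq_add_of_le (show 2 * k + 2 ≤ t by omega)
    rw [show 2 * k + 2 + m - 2 * (k + 1) = m by omega,
      show 2 * k + 2 + m - 2 * k = m + 2 by omega]
    linarith

variable (f : ρ → κ → K) (S : ℕ → List ρ) (C : ℕ → List κ) (t n : ℕ)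

/-- The contribution of the pair of residues `i`, `t - 1 - i`. -/
noncomputable def pairFactor (i : ℕ) : K :=
  (-1) ^ (t * n * ((C (t - 1 - i)).length + n)) *
    ldet f (S i ++ S (t - 1 - i)) (C i ++ C (t - 1 - i))

theorem ldet_inner_of_balanced (hS : ∀ i, (S i).length = n)
    (h0 : ∀ i j, i < t → j < t → j ≠ i → i + j + 1 ≠ t → ∀ r ∈ S i, ∀ c ∈ C j, f r c = 0)
    (d : ℕ) : ∀ k, k + d = t / 2 →
    (∀ i, k ≤ i → 2 * i + 1 < t → (C i).length + (C (t - 1 - i)).length = 2 * n) →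
    (∀ i, 2 * i + 1 = t → (C i).length = n) →
    ldet f (inner S t k) (inner C t k) =
      (∏ i ∈ Finset.Ico k (t / 2), pairFactor f S C t n i) *
        if Odd t then ldet f (S (t / 2)) (C (t / 2)) else 1 := by
  induction d with
  | zero =>
    rintro k hk - -
    obtain rfl : k = t / 2 := hk
    rw [inner_half, inner_half, Finset.Ico_self, Finset.prod_empty, one_mul]
    split_ifs
    · rfl
    · simp [ldet]
  | succ d ih =>
    intro k hk hb hm
    have h1 := ih (k + 1) (by omega) (fun i hi => hb i (by omega)) hm
    have h2 := hb k le_rfl (by omega)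
    have hCl := length_inner_of_balanced C t n d (k + 1) (by omega)
      (fun i hi => hb i (by omega)) hm
    have hSl := length_inner_of_balanced S t n d (k + 1) (by omega)
      (fun i hi _ => by rw [hS, hS]; ring) (fun i _ => hS i)
    have e := ldet_split_outer f (S k) (inner S t (k + 1)) (S (t - 1 - k)) [] (C k)
      (inner C t (k + 1)) (C (t - 1 - k)) (by rw [h2, hS, hS]; ring)
      (by rw [hCl, hSl]; simp) ?_
    -- With q columns of residue t-1-k, the moves cost (t-2k-2)n(n+q), which has the parity of
    -- tn(q+n). So the sign does not depend on the depth k except through q.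
    · rw [List.append_nil, List.append_nil] at e
      rw [inner_eq C (by omega), inner_eq S (by omega), e, h1,
        Finset.prod_eq_prod_Ico_succ_bot (show k < t / 2 by omega), hCl, hSl, hS, pairFactor,
        neg_one_pow_eq_of_even_add (b := t * n * ((C (t - 1 - k)).length + n))]
      · ring
      · obtain ⟨m, rfl⟩ := Nat.exists_eq_add_of_le (show 2 * k + 2 ≤ t by omega)
        rw [show 2 * k + 2 + m - 2 * (k + 1) = m by omega]
        generalize (C _).length = q
        exact ⟨(m + k + 1) * n * (q + n), by ring⟩
    · intro r hr c hc
      obtain ⟨j, hj1, hj2, hj⟩ := mem_inner hc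
      rcases List.mem_append.1 hr with hr | hr
      · exact h0 k j (by omega) (by omega) (by omega) (by omega) r hr c hj
      · exact h0 (t - 1 - k) j (by omega) (by omega) (by omega) (by omega) r hr c hj

/-- For k < i₀ the surplus column lies strictly inside, so the full row `u` stays with the inner
block. -/
theorem ldet_inner_outer (hS : ∀ i, (S i).length = n)
    (h0 : ∀ i j, i < t → j < t → j ≠ i → i + j + 1 ≠ t → ∀ r ∈ S i, ∀ c ∈ C j, f r c = 0)
    (u : ρ) (i₀ : ℕ) (hi₀ : 2 * i₀ + 1 ≤ t) (d : ℕ) : ∀ k, k + d = i₀ →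
    (∀ i, k ≤ i → 2 * i + 1 < t → (C i).length + (C (t - 1 - i)).length =
      2 * n + if i = i₀ then 1 else 0) →
    (∀ i, 2 * i + 1 = t → (C i).length = n + if i = i₀ then 1 else 0) →
    ldet f (inner S t k ++ [u]) (inner C t k) =
      (∏ i ∈ Finset.Ico k i₀, ((-1) ^ (C (t - 1 - i)).length * pairFactor f S C t n i)) *
        ldet f (inner S t i₀ ++ [u]) (inner C t i₀) := by
  induction d with
  | zero =>
    rintro k rfl - -
    simp
  | succ d ih =>
    intro k hk hb hm
    have h1 := ih (k + 1) (by omega) (fun i hi => hb i (by omega)) hm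
    have h2 := hb k le_rfl (by omega)
    rw [if_neg (by omega)] at h2
    have hCl := length_inner_of_middle C t n i₀ d (k + 1) (by omega) hi₀
      (fun i hi => hb i (by omega)) hm
    have hSl := length_inner_of_balanced S t n (t / 2 - (k + 1)) (k + 1) (by omega)
      (fun i hi _ => by rw [hS, hS]; ring) (fun i _ => hS i)
    have e := ldet_split_outer f (S k) (inner S t (k + 1)) (S (t - 1 - k)) [u] (C k)
      (inner C t (k + 1)) (C (t - 1 - k)) (by rw [hS, hS]; omega)
      (by rw [hCl, hSl]; simp) ?_
    -- The inner block has one column more than in the balanced case. Moving it past the q columns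
    -- of residue t-1-k gives the extra factor (-1)^q, the source of the first sum in ε₁.
    · rw [inner_eq C (by omega), inner_eq S (by omega), List.append_assoc, List.append_assoc, e, h1,
        Finset.prod_eq_prod_Ico_succ_bot (show k < i₀ by omega), hCl, hSl, hS, pairFactor,
        neg_one_pow_eq_of_even_add
          (b := (C (t - 1 - k)).length + t * n * ((C (t - 1 - k)).length + n)), pow_add]
      · ring
      · obtain ⟨m, rfl⟩ := Nat.exists_eq_add_of_le (show 2 * k + 2 ≤ t by omega)
        rw [show 2 * k + 2 + m - 2 * (k + 1) = m by omega]
        generalize (C _).length = q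
        exact ⟨(m + k + 1) * n * (q + n) + q, by ring⟩
    · intro r hr c hc
      obtain ⟨j, hj1, hj2, hj⟩ := mem_inner hc
      rcases List.mem_append.1 hr with hr | hr
      · exact h0 k j (by omega) (by omega) (by omega) (by omega) r hr c hj
      · exact h0 (t - 1 - k) j (by omega) (by omega) (by omega) (by omega) r hr c hj

theorem ldet_inner_middle_eq (hS : ∀ i, (S i).length = n)
    (h0 : ∀ i j, i < t → j < t → j ≠ i → i + j + 1 ≠ t → ∀ r ∈ S i, ∀ c ∈ C j, f r c = 0)
    (u : ρ) (i₀ : ℕ) (hi₀ : 2 * i₀ + 1 = t)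
    (hb : ∀ i, 2 * i + 1 < t → (C i).length + (C (t - 1 - i)).length =
      2 * n + if i = i₀ then 1 else 0)
    (hm : ∀ i, 2 * i + 1 = t → (C i).length = n + if i = i₀ then 1 else 0) :
    ldet f (inner S t 0 ++ [u]) (inner C t 0) =
      (∏ i ∈ Finset.range i₀, ((-1) ^ (C (t - 1 - i)).length * pairFactor f S C t n i)) *
        ldet f (S i₀ ++ [u]) (C i₀) := by
  rw [ldet_inner_outer f S C t n hS h0 u i₀ hi₀.le i₀ 0 (by omega) (fun i _ => hb i) hm,
    Finset.range_eq_Ico]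
  have e := inner_half C t
  have e' := inner_half S t
  rw [show t / 2 = i₀ by omega, if_pos ⟨i₀, hi₀.symm⟩] at e e'
  rw [e, e']

/-- At depth i₀ the outer pair carries the surplus column and takes the full row with it; what
remains inside is balanced. -/
theorem ldet_inner_middle_ne (hS : ∀ i, (S i).length = n)
    (h0 : ∀ i j, i < t → j < t → j ≠ i → i + j + 1 ≠ t → ∀ r ∈ S i, ∀ c ∈ C j, f r c = 0)
    (u : ρ) (i₀ : ℕ) (hi₀ : 2 * i₀ + 1 < t)
    (hb : ∀ i, 2 * i + 1 < t → (C i).length + (C (t - 1 - i)).length =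
      2 * n + if i = i₀ then 1 else 0)
    (hm : ∀ i, 2 * i + 1 = t → (C i).length = n + if i = i₀ then 1 else 0) :
    ldet f (inner S t 0 ++ [u]) (inner C t 0) =
      (-1) ^ (t * n) *
      (∏ i ∈ Finset.range i₀, ((-1) ^ (C (t - 1 - i)).length * pairFactor f S C t n i)) *
        ((-1) ^ (t * n * ((C (t - 1 - i₀)).length + n)) *
          ldet f (S i₀ ++ (S (t - 1 - i₀) ++ [u])) (C i₀ ++ C (t - 1 - i₀))) *
        (∏ i ∈ Finset.Ico (i₀ + 1) (t / 2), pairFactor f S C t n i) *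
        if Odd t then ldet f (S (t / 2)) (C (t / 2)) else 1 := by
  rw [ldet_inner_outer f S C t n hS h0 u i₀ hi₀.le i₀ 0 (by omega) (fun i _ => hb i) hm,
    Finset.range_eq_Ico]
  have hb' : ∀ i, i₀ + 1 ≤ i → 2 * i + 1 < t →
      (C i).length + (C (t - 1 - i)).length = 2 * n := fun i hi hit => by
    rw [hb i hit, if_neg (by omega), add_zero]
  have hm' : ∀ i, 2 * i + 1 = t → (C i).length = n := fun i hi => by
    rw [hm i hi, if_neg (by omega), add_zero]
  have hCl := length_inner_of_balanced C t n (t / 2 - (i₀ + 1)) (i₀ + 1) (by omega) hb' hm'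
  have hSl := length_inner_of_balanced S t n (t / 2 - (i₀ + 1)) (i₀ + 1) (by omega)
    (fun i hi _ => by rw [hS, hS]; ring) (fun i _ => hS i)
  have h2 := hb i₀ hi₀
  rw [if_pos rfl] at h2
  have e := ldet_split_outer_full f (S i₀) (inner S t (i₀ + 1)) (S (t - 1 - i₀)) [u] (C i₀)
      (inner C t (i₀ + 1)) (C (t - 1 - i₀)) (by rw [hS, hS, List.length_singleton]; omega)
      (by rw [hCl, hSl]) ?_
  -- The inner rows now also pass the row `u`, which contributes the extra (-1)^(tn).
  · rw [inner_eq C (by omega), inner_eq S (by omega), List.append_assoc, List.append_assoc, e,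
      ldet_inner_of_balanced f S C t n hS h0 (t / 2 - (i₀ + 1)) (i₀ + 1) (by omega) hb' hm',
      hCl, hSl, hS, neg_one_pow_eq_of_even_add
        (b := t * n + t * n * ((C (t - 1 - i₀)).length + n)), pow_add]
    · ring
    · obtain ⟨m, rfl⟩ := Nat.exists_eq_add_of_le (show 2 * i₀ + 2 ≤ t by omega)
      rw [show 2 * i₀ + 2 + m - 2 * (i₀ + 1) = m by omega]
      generalize (C _).length = q
      exact ⟨(m + i₀ + 1) * n * (q + n + 1), by rw [List.length_singleton]; ring⟩
  · intro r hr c hc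
    obtain ⟨j, hj1, hj2, hj⟩ := mem_inner hr
    rcases List.mem_append.1 hc with hc | hc
    · exact h0 j i₀ (by omega) (by omega) (by omega) (by omega) r hj c hc
    · exact h0 j (t - 1 - i₀) (by omega) (by omega) (by omega) (by omega) r hj c hc

end Peeling

end OddOrthFactor
namespace OddOrthFactor

/-! ### Separating residues by a Fourier matrix -/

section Reduction

/-- The elements of the strictly decreasing tuple `b` that are congruent to `i` modulo `t`. -/
def resClass {N : ℕ} (b : Fin N → ℕ) (t i : ℕ) : List ℕ := (List.ofFn b).filter (fun c => c % t = i)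

theorem mem_resClass {N : ℕ} {b : Fin N → ℕ} {t i c : ℕ} :
    c ∈ resClass b t i ↔ (∃ j, b j = c) ∧ c % t = i := by
  simp [resClass, List.mem_ofFn]

theorem pairwise_resClass {N : ℕ} {b : Fin N → ℕ} (hb : StrictAnti b) (t i : ℕ) :
    (resClass b t i).Pairwise (· > ·) := by
  apply List.Pairwise.filter
  rw [List.pairwise_ofFn]
  exact fun i j hij => hb hij

/-- Both lists are sorted by the injective key (residue, reversed value) and have the same entries,
hence they coincide. -/
theorem ofFn_comp_sort {N : ℕ} {b : Fin N → ℕ} (hb : StrictAnti b) {t : ℕ} (ht : 0 < t) :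
    List.ofFn (b ∘ Tuple.sort fun j => toLex (b j % t, OrderDual.toDual (b j))) =
      inner (resClass b t) t 0 := by
  set key : ℕ → ℕ ×ₗ ℕᵒᵈ := fun c => toLex (c % t, OrderDual.toDual c) with hkey
  have hinj : Function.Injective key := by
    intro c d h
    have := congrArg (fun z => OrderDual.ofDual (ofLex z).2) h
    simpa [hkey] using this
  set σ := Tuple.sort fun j => toLex (b j % t, OrderDual.toDual (b j)) with hσ
  have hlt : (inner (resClass b t) t 0).Pairwise fun c d => key c < key d := by
    rw [inner, List.pairwise_flatMap]
    constructor
    · intro i _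
      refine (pairwise_resClass hb t i).imp_of_mem fun {c d} hc hd hcd => ?_
      rw [mem_resClass] at hc hd
      rw [Prod.Lex.lt_iff]
      right
      exact ⟨by simp [hkey, hc.2, hd.2], hcd⟩
    · refine (List.pairwise_lt_range' (s := 0) (n := t - 2 * 0)).imp ?_
      intro i j hij c hc d hd
      rw [mem_resClass] at hc hd
      rw [Prod.Lex.lt_iff]
      left
      simp [hkey, hc.2, hd.2, hij]
  have hle : (List.ofFn (b ∘ σ)).Pairwise fun c d => key c ≤ key d := by
    rw [List.pairwise_ofFn]
    intro i j hij
    exact Tuple.monotone_sort (fun j => toLex (b j % t, OrderDual.toDual (b j))) hij.le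
  have hnd : (List.ofFn (b ∘ σ)).Nodup := List.nodup_ofFn.2 (hb.injective.comp σ.injective)
  have hnd' : (inner (resClass b t) t 0).Nodup := hlt.imp fun h e => by subst e; exact lt_irrefl _ h
  refine List.Perm.eq_of_pairwise (le := fun c d => key c ≤ key d)
    (fun c d _ _ h1 h2 => hinj (le_antisymm h1 h2)) hle (hlt.imp le_of_lt) ?_
  rw [List.perm_ext_iff_of_nodup hnd hnd']
  intro c
  simp only [inner, List.mem_flatMap, List.mem_range'_1, mem_resClass, List.mem_ofFn,
    Function.comp_apply]
  constructor
  · rintro ⟨j, rfl⟩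
    exact ⟨b (σ j) % t, ⟨Nat.zero_le _, by simpa using Nat.mod_lt _ ht⟩, ⟨σ j, rfl⟩, rfl⟩
  · rintro ⟨i, _, ⟨j, rfl⟩, _⟩
    exact ⟨σ.symm j, by simp⟩

variable {K : Type*} [Field K] {n : ℕ}

/-- The kernel obtained from `(z, β) ↦ z ^ (β + 1) - z⁻¹ ^ β` by separating the residues of `β`
modulo `t` in the variables `ω ^ a * x b`. -/
def sepKernel (t : ℕ) (x : Fin n → K) (y : K) : Option (ℕ × Fin n) → ℕ → K
  | some (i, b), β =>
    (if β % t = i then x b ^ (β + 1) else 0) - if β % t + i + 1 = t then (x b)⁻¹ ^ β else 0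
  | none, β => y ^ (β + 1) - y⁻¹ ^ β

/-- The rows of `sepKernel` that belong to the residue `i`. -/
def sepRows (n i : ℕ) : List (Option (ℕ × Fin n)) := List.ofFn fun b => some (i, b)

@[simp] theorem length_sepRows (n i : ℕ) : (sepRows n i).length = n := List.length_ofFn

theorem sepKernel_eq_zero (t : ℕ) (x : Fin n → K) (y : K) {N : ℕ} (b : Fin N → ℕ) (i j : ℕ)
    (_ : i < t) (_ : j < t) (hne : j ≠ i) (hsum : i + j + 1 ≠ t) :
    ∀ r ∈ sepRows n i, ∀ c ∈ resClass b t j, sepKernel t x y r c = 0 := by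
  intro r hr c hc
  rw [mem_resClass] at hc
  simp only [sepRows, List.mem_ofFn] at hr
  obtain ⟨k, rfl⟩ := hr
  rw [sepKernel, hc.2, if_neg hne, if_neg (by omega), sub_zero]

/-- All rows of `sepKernel`. -/
def allRows (t n : ℕ) : Fin (t * n + 1) → Option (ℕ × Fin n) :=
  Fin.snoc (α := fun _ => Option (ℕ × Fin n))
    (fun j => some (((finProdFinEquiv.symm j).1 : ℕ), (finProdFinEquiv.symm j).2)) none

/-- `finProdFinEquiv` sends (i, j) to i n + j, so the rows already come grouped by residue. -/
theorem ofFn_allRows (t n : ℕ) : List.ofFn (allRows t n) = inner (sepRows n) t 0 ++ [none] := by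
  rw [List.ofFn_succ']
  simp only [allRows, Fin.snoc_castSucc, Fin.snoc_last, List.concat_eq_append]
  congr 1
  rw [List.ofFn_mul, inner, List.flatMap_def, List.range'_eq_map_range]
  congr 1
  rw [List.ofFn_eq_map, ← List.map_coe_finRange_eq_range]
  simp only [List.map_map]
  congr 1
  funext i
  simp only [Function.comp_apply, zero_add]
  congr 1
  funext j
  have : finProdFinEquiv.symm ⟨i * n + j, by
      calc i * n + j < (i + 1) * n := by rw [add_mul, one_mul]; omega
        _ ≤ t * n := Nat.mul_le_mul_right _ i.isLt⟩ = ((i, j) : Fin t × Fin n) := by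
    rw [Equiv.symm_apply_eq]
    ext
    simp [finProdFinEquiv, mul_comm, add_comm]
  rw [this]

/-- The matrix `(ω ^ (a * (i + 1)))`. -/
def fourierMatrix (ω : K) (t : ℕ) : Matrix (Fin t) (Fin t) K :=
  Matrix.of fun a i => ω ^ ((a : ℕ) * (i + 1))

/-- Taking ω^a out of row a leaves a Vandermonde matrix in the distinct powers of ω. -/
theorem det_fourierMatrix_ne_zero {ω : K} {t : ℕ} (ht : 0 < t) (hω : IsPrimitiveRoot ω t) :
    (fourierMatrix ω t).det ≠ 0 := by
  have : fourierMatrix ω t = Matrix.of fun a i : Fin t =>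
      ω ^ (a : ℕ) * Matrix.vandermonde (fun a : Fin t => ω ^ (a : ℕ)) a i := by
    ext a i
    simp only [fourierMatrix, Matrix.of_apply, Matrix.vandermonde_apply]
    ring
  rw [this, Matrix.det_mul_column]
  refine mul_ne_zero (Finset.prod_ne_zero_iff.2 fun a _ => pow_ne_zero _ (hω.ne_zero ht.ne')) ?_
  rw [Matrix.det_vandermonde_ne_zero_iff]
  intro a b h
  exact Fin.ext (hω.pow_inj a.isLt b.isLt h)

open scoped Kronecker in
/-- `fourierMatrix` acting on the twisted variables, and trivially on the last one. -/
def twistMatrix (ω : K) (t n : ℕ) : Matrix (Fin (t * n + 1)) (Fin (t * n + 1)) K :=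
  Matrix.reindex finSumFinEquiv finSumFinEquiv
    (Matrix.fromBlocks (Matrix.reindex finProdFinEquiv finProdFinEquiv
      (fourierMatrix ω t ⊗ₖ (1 : Matrix (Fin n) (Fin n) K))) 0 0 (1 : Matrix (Fin 1) (Fin 1) K))

theorem det_twistMatrix_ne_zero {ω : K} {t : ℕ} (n : ℕ) (ht : 0 < t) (hω : IsPrimitiveRoot ω t) :
    (twistMatrix ω t n).det ≠ 0 := by
  rw [twistMatrix, Matrix.det_reindex_self, Matrix.det_fromBlocks_zero₁₂, Matrix.det_reindex_self,
    Matrix.det_kronecker]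
  simp [det_fourierMatrix_ne_zero ht hω]

theorem sum_fourierMatrix_mul_sepKernel {ω : K} {t : ℕ} (ht : 0 < t) (hω : ω ^ t = 1)
    (x : Fin n → K) (y : K) (a : Fin t) (b : Fin n) (β : ℕ) :
    ∑ i : Fin t, fourierMatrix ω t a i * sepKernel t x y (some (i, b)) β =
      (ω ^ (a : ℕ) * x b) ^ (β + 1) - (ω ^ (a : ℕ) * x b)⁻¹ ^ β := by
  have hω0 : ω ≠ 0 := by rintro rfl; simp [ht.ne'] at hω
  have hm : β % t < t := Nat.mod_lt _ ht
  simp only [sepKernel, mul_sub, Finset.sum_sub_distrib]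
  congr 1
  · rw [Finset.sum_eq_single ⟨β % t, hm⟩]
    · simp only [fourierMatrix, Matrix.of_apply, if_true, mul_pow, ← pow_mul]
      congr 1
      conv_rhs => rw [← Nat.mod_add_div β t]
      rw [show (a : ℕ) * (β % t + t * (β / t) + 1) =
        a * (β % t + 1) + t * (a * (β / t)) by ring, pow_add ω, pow_mul ω t, hω, one_pow, mul_one]
    · intro i _ hi
      rw [if_neg, mul_zero]
      exact fun h => hi (Fin.ext h.symm)
    · simp
  -- The inverse power has ω^(-aβ) = ω^(a(t - β mod t)), which is the character of index t-1-(β mod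
  -- t).
  · rw [Finset.sum_eq_single ⟨t - 1 - β % t, by omega⟩]
    · rw [if_pos (by simp only; omega)]
      simp only [fourierMatrix, Matrix.of_apply, mul_inv, mul_pow]
      congr 1
      rw [← inv_pow, ← pow_mul, inv_pow]
      apply eq_inv_of_mul_eq_one_left
      rw [← pow_add]
      conv_lhs => rw [show t - 1 - β % t + 1 = t - β % t by omega]
      rw [← mul_add]
      have e : t - β % t + β = t * (β / t + 1) := by
        have := Nat.mod_add_div β t
        rw [mul_add, mul_one]
        omega
      rw [e, show (a : ℕ) * (t * (β / t + 1)) = t * (a * (β / t + 1)) by ring, pow_mul, hω, one_pow]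
    · intro i _ hi
      rw [if_neg, mul_zero]
      intro h
      exact hi (Fin.ext (by simp only; omega))
    · simp

/-- The variables `ω ^ a * x b`, followed by `y`. -/
def twistVars (t : ℕ) (ω : K) (x : Fin n → K) (y : K) : Fin (t * n + 1) → K :=
  Fin.snoc (α := fun _ => K)
    (fun j => ω ^ ((finProdFinEquiv.symm j).1 : ℕ) * x (finProdFinEquiv.symm j).2) y

theorem twistMatrix_mul {ω : K} {t : ℕ} (ht : 0 < t) (hω : ω ^ t = 1)
    (x : Fin n → K) (y : K) (b : Fin (t * n + 1) → ℕ) :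
    (Matrix.of fun i j => twistVars t ω x y i ^ (b j + 1) - (twistVars t ω x y i)⁻¹ ^ b j) =
      twistMatrix ω t n * Matrix.of fun i j => sepKernel t x y (allRows t n i) (b j) := by
  ext i j
  rw [Matrix.mul_apply, Fin.sum_univ_castSucc]
  refine Fin.lastCases ?_ (fun i => ?_) i
  · have h1 : ∀ k : Fin (t * n), twistMatrix ω t n (Fin.last _) k.castSucc = 0 := by
      intro k
      have e1 : finSumFinEquiv.symm (Fin.last (t * n)) = Sum.inr (0 : Fin 1) :=
        finSumFinEquiv_symm_last
      have e2 : finSumFinEquiv.symm k.castSucc = (Sum.inl k : Fin (t * n) ⊕ Fin 1) :=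
        finSumFinEquiv_symm_apply_castAdd k
      simp [twistMatrix, e1, e2]
    have h2 : twistMatrix ω t n (Fin.last _) (Fin.last _) = 1 := by
      have e1 : finSumFinEquiv.symm (Fin.last (t * n)) = Sum.inr (0 : Fin 1) :=
        finSumFinEquiv_symm_last
      simp [twistMatrix, e1]
    simp [h1, h2, twistVars, allRows, sepKernel]
  · have h1 : ∀ k : Fin (t * n), twistMatrix ω t n i.castSucc k.castSucc =
        fourierMatrix ω t (finProdFinEquiv.symm i).1 (finProdFinEquiv.symm k).1 *
          (1 : Matrix (Fin n) (Fin n) K) (finProdFinEquiv.symm i).2 (finProdFinEquiv.symm k).2 := by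
      intro k
      have e2 : ∀ k : Fin (t * n), finSumFinEquiv.symm k.castSucc =
        (Sum.inl k : Fin (t * n) ⊕ Fin 1) := fun k => finSumFinEquiv_symm_apply_castAdd k
      simp only [twistMatrix, Matrix.reindex_apply, Matrix.submatrix_apply, e2,
        Matrix.fromBlocks_apply₁₁, Matrix.kroneckerMap_apply]
    have h2 : twistMatrix ω t n i.castSucc (Fin.last _) = 0 := by
      have e1 : finSumFinEquiv.symm (Fin.last (t * n)) = Sum.inr (0 : Fin 1) :=
        finSumFinEquiv_symm_last
      have e2 : finSumFinEquiv.symm i.castSucc = (Sum.inl i : Fin (t * n) ⊕ Fin 1) :=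
        finSumFinEquiv_symm_apply_castAdd i
      simp [twistMatrix, e1, e2]
    rw [h2, zero_mul, add_zero]
    simp only [h1, Matrix.of_apply, twistVars, allRows, Fin.snoc_castSucc]
    rw [← sum_fourierMatrix_mul_sepKernel ht hω x y,
      ← finProdFinEquiv.sum_comp, Fintype.sum_prod_type]
    refine Finset.sum_congr rfl fun k _ => ?_
    rw [Finset.sum_eq_single (finProdFinEquiv.symm i).2]
    · rw [Equiv.symm_apply_apply, Matrix.one_apply_eq, mul_one]
    · intro l _ hl
      rw [Equiv.symm_apply_apply, Matrix.one_apply_ne (Ne.symm hl), mul_zero, zero_mul]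
    · simp

theorem det_odd_eq_ldet {ω : K} {t : ℕ} (ht : 0 < t) (hω : ω ^ t = 1)
    (x : Fin n → K) (y : K) {b : Fin (t * n + 1) → ℕ} (hb : StrictAnti b) :
    (Matrix.of fun i j =>
      twistVars t ω x y i ^ (b j + 1) - (twistVars t ω x y i)⁻¹ ^ b j).det =
      (twistMatrix ω t n).det *
      (((Equiv.Perm.sign (Tuple.sort fun j => toLex (b j % t, OrderDual.toDual (b j))) : ℤ) : K) *
      ldet (sepKernel t x y) (inner (sepRows n) t 0 ++ [none]) (inner (resClass b t) t 0)) := by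
  rw [twistMatrix_mul ht hω, Matrix.det_mul, ← ldet_ofFn, ofFn_allRows,
    ldet_ofFn_comp_perm _ _ b (Tuple.sort fun j => toLex (b j % t, OrderDual.toDual (b j))),
    ofFn_comp_sort hb ht]

end Reduction

end OddOrthFactor
namespace OddOrthFactor

/-! ### Evaluating the blocks as Schur and odd orthogonal numerators -/

section Blocks

theorem of_snoc {K α : Type*} {N : ℕ} (g : α → Fin (N + 1) → K) (w : Fin N → α) (z : α) :
    (Matrix.of fun r j => g (Fin.snoc (α := fun _ => α) w z r) j) =
      Matrix.of (Fin.snoc (α := fun _ => Fin (N + 1) → K) (fun r => g (w r)) (g z)) := by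
  ext r j
  refine Fin.lastCases ?_ (fun r => ?_) r <;> simp

variable {K : Type*} [Field K]

/-- The numerator of `schur`. -/
def schurNum {N : ℕ} (a : Fin N → ℕ) (x : Fin N → K) : K :=
  (Matrix.of fun i j : Fin N => x i ^ (a j + (N - 1 - j))).det

/-- The denominator of `schur`. -/
def schurDen {N : ℕ} (x : Fin N → K) : K :=
  (Matrix.of fun i j : Fin N => x i ^ (N - 1 - (j : ℕ))).det

/-- The numerator of `oo`. -/
def ooNum {N : ℕ} (a : Fin N → ℕ) (x : Fin N → K) : K :=
  (Matrix.of fun i j : Fin N =>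
      x i ^ (a j + (N - 1 - j) + 1) - (x i)⁻¹ ^ (a j + (N - 1 - j))).det

/-- The denominator of `oo`. -/
def ooDen {N : ℕ} (x : Fin N → K) : K :=
  (Matrix.of fun i j : Fin N => x i ^ (N - 1 - (j : ℕ) + 1) - (x i)⁻¹ ^ (N - 1 - (j : ℕ))).det

theorem schur_mul_schurDen {N : ℕ} (a : Fin N → ℕ) {x : Fin N → K} (h : schurDen x ≠ 0) :
    schurNum a x = schur a x * schurDen x :=
  (div_mul_cancel₀ _ h).symm

theorem oo_mul_ooDen {N : ℕ} (a : Fin N → ℕ) {x : Fin N → K} (h : ooDen x ≠ 0) :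
    ooNum a x = oo a x * ooDen x :=
  (div_mul_cancel₀ _ h).symm

theorem schur_zero {N : ℕ} {a : Fin N → ℕ} (ha : ∀ j, a j = 0) {x : Fin N → K}
    (h : schurDen x ≠ 0) : schur a x = 1 := by
  have : schurNum a x = schurDen x := by simp [schurNum, schurDen, ha]
  rw [schur_mul_schurDen a h] at this
  exact mul_right_cancel₀ h (by rw [this, one_mul])

theorem oo_zero {N : ℕ} {a : Fin N → ℕ} (ha : ∀ j, a j = 0) {x : Fin N → K}
    (h : ooDen x ≠ 0) : oo a x = 1 := by
  have : ooNum a x = ooDen x := by simp [ooNum, ooDen, ha]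
  rw [oo_mul_ooDen a h] at this
  exact mul_right_cancel₀ h (by rw [this, one_mul])

/-- The list `t (μ_j + p - j) + i`, `1 ≤ j ≤ p`. -/
def partClass (μ : YoungDiagram) (t i p : ℕ) : List ℕ :=
  List.ofFn fun j : Fin p => t * (μ.rowLen j + (p - 1 - j)) + i

@[simp] theorem length_partClass (μ : YoungDiagram) (t i p : ℕ) :
    (partClass μ t i p).length = p := List.length_ofFn

/-- The columns of the block of the pair of residues `i`, `t - 1 - i`. -/
def pairCol (μ ν : YoungDiagram) (t i p q N : ℕ) (j : Fin N) : ℕ :=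
  if (j : ℕ) < p then t * (μ.rowLen j + (p - 1 - j)) + i
  else t * (ν.rowLen (N - 1 - j) + (q - 1 - (N - 1 - j))) + (t - 1 - i)

theorem partClass_append_reverse (μ ν : YoungDiagram) (t i : ℕ) {p q N : ℕ} (h : p + q = N) :
    partClass μ t i p ++ (partClass ν t (t - 1 - i) q).reverse =
      List.ofFn (pairCol μ ν t i p q N) := by
  subst h
  apply List.ext_getElem
  · simp
  · intro k hk hk'
    simp only [List.length_ofFn] at hk'
    rw [List.getElem_ofFn, pairCol, List.getElem_append]
    simp only [length_partClass]
    split_ifs with hp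
    · simp [partClass]
    · rw [List.getElem_reverse]
      simp only [length_partClass]
      simp only [partClass, List.getElem_ofFn]
      rw [show q - 1 - (k - p) = p + q - 1 - k by omega]

/-- The sign of a column of the pair block. -/
def pairSign (K : Type*) [Field K] (p : ℕ) {N : ℕ} (j : Fin N) : K := if (j : ℕ) < p then 1 else -1

/-- The entries of the pair block, up to a factor for each row. -/
def pairEntry (μ ν : YoungDiagram) (p q N : ℕ) (z : K) (j : Fin N) : K :=
  pairSign K p j * z ^ ((glue μ ν N j + (N - 1 - j) : ℕ) - (ν.rowLen 0 + q : ℕ) : ℤ)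

/-- Shifting the exponents of the glued partition by ν_1 + q recovers both classes: here the
beta-numbers of μ, and in `glue_of_ge` the values -(b+1) for the beta-numbers b of ν. -/
theorem glue_of_lt {μ ν : YoungDiagram} {p q N : ℕ} (h : p + q = N)
    (hν : ∀ j, q ≤ j → ν.rowLen j = 0) {j : Fin N} (hj : (j : ℕ) < p) :
    ((glue μ ν N j + (N - 1 - j) : ℕ) - (ν.rowLen 0 + q : ℕ) : ℤ) =
      (μ.rowLen j + (p - 1 - j) : ℕ) := by
  rw [glue, hν (N - 1 - j) (by omega)]
  omega

theorem glue_of_ge {μ ν : YoungDiagram} {p q N : ℕ} (h : p + q = N)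
    (hμ : ∀ j, p ≤ j → μ.rowLen j = 0) {j : Fin N} (hj : ¬ (j : ℕ) < p) :
    ((glue μ ν N j + (N - 1 - j) : ℕ) - (ν.rowLen 0 + q : ℕ) : ℤ) =
      -(ν.rowLen (N - 1 - j) + (q - 1 - (N - 1 - j)) + 1 : ℕ) := by
  rw [glue, hμ j (by omega)]
  have := ν.rowLen_anti 0 (N - 1 - j) (Nat.zero_le _)
  have := j.isLt
  omega

theorem pairCol_mod (μ ν : YoungDiagram) {t i : ℕ} (p q : ℕ) {N : ℕ} (hi : 2 * i + 1 < t)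
    (j : Fin N) :
    pairCol μ ν t i p q N j % t = if (j : ℕ) < p then i else t - 1 - i := by
  rw [pairCol]
  split_ifs
  · rw [Nat.mul_add_mod, Nat.mod_eq_of_lt (by omega)]
  · rw [Nat.mul_add_mod, Nat.mod_eq_of_lt (by omega)]

section PairEntries

variable {μ ν : YoungDiagram} {t i p q N : ℕ} (h : p + q = N)
  (hμ : ∀ j, p ≤ j → μ.rowLen j = 0) (hν : ∀ j, q ≤ j → ν.rowLen j = 0)
  (hi : 2 * i + 1 < t)
include h hμ hν hi

/-- For β = tB+i one has z^(β+1) = z^(i+1) (z^t)^B, and for β = tB+(t-1-i) one has z^(β+1) = z^(-i)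
(z^(-t))^(-(B+1)). Thus all columns of the pair become powers of z^t or z^(-t), up to a row factor
and a column sign. -/
theorem pow_pairCol_succ (z : K) (hz : z ≠ 0) (j : Fin N) :
    z ^ (pairCol μ ν t i p q N j + 1) =
      if (j : ℕ) < p then z ^ (i + 1) * pairEntry μ ν p q N (z ^ t) j
      else -(z⁻¹ ^ i * pairEntry μ ν p q N (z⁻¹ ^ t) j) := by
  rw [pairEntry, pairEntry, pairSign, pairCol]
  split_ifs with hj
  · rw [glue_of_lt h hν hj, zpow_natCast, ← pow_mul, one_mul, ← pow_add]
    congr 1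
    ring
  · rw [glue_of_ge h hμ hj, zpow_neg, zpow_natCast, inv_pow z t, inv_pow _ (_ + 1), inv_inv]
    generalize ν.rowLen (N - 1 - j) + (q - 1 - (N - 1 - j)) = B
    have e : t * B + (t - 1 - i) + 1 + i = t * (B + 1) := by
      rw [mul_add, mul_one]
      omega
    rw [← pow_mul, ← e, pow_add z _ i, inv_pow]
    field_simp

theorem inv_pow_pairCol (z : K) (hz : z ≠ 0) (j : Fin N) :
    z⁻¹ ^ pairCol μ ν t i p q N j =
      if (j : ℕ) < p then z⁻¹ ^ i * pairEntry μ ν p q N (z⁻¹ ^ t) j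
      else -(z ^ (i + 1) * pairEntry μ ν p q N (z ^ t) j) := by
  -- The previous formula at 1/z computes z^(-(β+1)); one factor z is then moved across.
  have := pow_pairCol_succ h hμ hν hi z⁻¹ (inv_ne_zero hz) j
  rw [inv_inv] at this
  rw [pow_succ, ← eq_mul_inv_iff_mul_eq₀ (inv_ne_zero hz), inv_inv] at this
  rw [this]
  split_ifs
  · rw [pow_succ]
    field_simp
  · ring

theorem sepKernel_pairCol_left {n : ℕ} (x : Fin n → K) (y : K) (hx : ∀ b, x b ≠ 0) (b : Fin n)
    (j : Fin N) :
    sepKernel t x y (some (i, b)) (pairCol μ ν t i p q N j) =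
      x b ^ (i + 1) * pairEntry μ ν p q N (x b ^ t) j := by
  rw [sepKernel, pairCol_mod μ ν p q hi, pow_pairCol_succ h hμ hν hi _ (hx b),
    inv_pow_pairCol h hμ hν hi _ (hx b)]
  split_ifs <;> first | omega | ring

theorem sepKernel_pairCol_right {n : ℕ} (x : Fin n → K) (y : K) (hx : ∀ b, x b ≠ 0) (b : Fin n)
    (j : Fin N) :
    sepKernel t x y (some (t - 1 - i, b)) (pairCol μ ν t i p q N j) =
      -(x b)⁻¹ ^ i * pairEntry μ ν p q N ((x b)⁻¹ ^ t) j := by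
  rw [sepKernel, pairCol_mod μ ν p q hi, pow_pairCol_succ h hμ hν hi _ (hx b),
    inv_pow_pairCol h hμ hν hi _ (hx b)]
  split_ifs <;> first | omega | ring

theorem sepKernel_pairCol_last {n : ℕ} (x : Fin n → K) (y : K) (hy : y ≠ 0) (j : Fin N) :
    sepKernel t x y none (pairCol μ ν t i p q N j) =
      y ^ (i + 1) * pairEntry μ ν p q N (y ^ t) j - y⁻¹ ^ i * pairEntry μ ν p q N (y⁻¹ ^ t) j := by
  rw [sepKernel, pow_pairCol_succ h hμ hν hi _ hy, inv_pow_pairCol h hμ hν hi _ hy]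
  split_ifs <;> ring

end PairEntries

theorem prod_pairSign {p q N : ℕ} (h : p + q = N) :
    ∏ j : Fin N, pairSign K p j = (-1) ^ q := by
  subst h
  rw [Fin.prod_univ_add]
  simp [pairSign]

theorem det_pairEntry (μ ν : YoungDiagram) {p q N : ℕ} (h : p + q = N) (w : Fin N → K)
    (hw : ∀ r, w r ≠ 0) :
    (Matrix.of fun r j => pairEntry μ ν p q N (w r) j).det =
      (-1) ^ q * ((∏ r, w r)⁻¹ ^ (ν.rowLen 0 + q) * schurNum (glue μ ν N) w) := by
  have e : (Matrix.of fun r j => pairEntry μ ν p q N (w r) j) =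
      Matrix.of fun r j => pairSign K p j * Matrix.of (fun r j =>
        ((w r)⁻¹ ^ (ν.rowLen 0 + q)) * Matrix.of (fun r j : Fin N =>
          w r ^ (glue μ ν N j + (N - 1 - j))) r j) r j := by
    ext r j
    simp only [Matrix.of_apply, pairEntry]
    rw [zpow_sub₀ (hw r), zpow_natCast, zpow_natCast, inv_pow]
    field_simp
  rw [e, Matrix.det_mul_row, Matrix.det_mul_column, prod_pairSign h, schurNum,
    Finset.prod_pow, Finset.prod_inv_distrib]

/-- The variables `x ^ t`, followed by their inverses. -/
def doubled {n : ℕ} (t : ℕ) (x : Fin n → K) : Fin (n + n) → K :=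
  Fin.append (fun i => x i ^ t) (fun i => (x i)⁻¹ ^ t)

theorem doubled_ne_zero {n : ℕ} (t : ℕ) {x : Fin n → K} (hx : ∀ b, x b ≠ 0) (r : Fin (n + n)) :
    doubled t x r ≠ 0 := by
  refine Fin.addCases (fun b => ?_) (fun b => ?_) r
  · rw [doubled, Fin.append_left]
    exact pow_ne_zero _ (hx b)
  · rw [doubled, Fin.append_right]
    exact pow_ne_zero _ (inv_ne_zero (hx b))

theorem prod_doubled {n : ℕ} (t : ℕ) {x : Fin n → K} (hx : ∀ b, x b ≠ 0) :
    ∏ r, doubled t x r = 1 := by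
  rw [Fin.prod_univ_add]
  simp only [doubled, Fin.append_left, Fin.append_right]
  rw [← Finset.prod_mul_distrib]
  refine Finset.prod_eq_one fun b _ => ?_
  rw [← mul_pow, mul_inv_cancel₀ (hx b), one_pow]

/-- The factors of the rows of the pair block. -/
def pairCoeff {n : ℕ} (i : ℕ) (x : Fin n → K) : Fin (n + n) → K :=
  Fin.append (fun b => x b ^ (i + 1)) (fun b => -(x b)⁻¹ ^ i)

theorem prod_pairCoeff {n : ℕ} (i : ℕ) {x : Fin n → K} (hx : ∀ b, x b ≠ 0) :
    ∏ r, pairCoeff i x r = (-1) ^ n * ∏ b, x b := by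
  rw [Fin.prod_univ_add]
  simp only [pairCoeff, Fin.append_left, Fin.append_right]
  rw [← Finset.prod_mul_distrib]
  have : ∀ b, x b ^ (i + 1) * -(x b)⁻¹ ^ i = -1 * x b := by
    intro b
    have := hx b
    rw [pow_succ, inv_pow]
    field_simp
  simp_rw [this]
  rw [Finset.prod_mul_distrib]
  simp

theorem sepRows_append (n i j : ℕ) :
    sepRows n i ++ sepRows n j =
      List.ofFn (Fin.append (fun b : Fin n => some (i, b)) fun b => some (j, b)) := by
  rw [List.ofFn_fin_append, sepRows, sepRows]

/-- The reversal of q columns gives C(q,2) and their column signs give q, together C(q+1,2), the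
binomial in ε₁. The row factors w^(-(ν_1+q)) cancel because the variables come in inverse pairs. -/
theorem ldet_pairBlock {μ ν : YoungDiagram} {t i p q n : ℕ} (h : p + q = n + n)
    (hμ : ∀ j, p ≤ j → μ.rowLen j = 0) (hν : ∀ j, q ≤ j → ν.rowLen j = 0)
    (hi : 2 * i + 1 < t) {x : Fin n → K} (y : K) (hx : ∀ b, x b ≠ 0) :
    ldet (sepKernel t x y) (sepRows n i ++ sepRows n (t - 1 - i))
        (partClass μ t i p ++ partClass ν t (t - 1 - i) q) =
      ((-1) ^ n * ∏ b, x b) * (-1) ^ ((q + 1).choose 2) *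
        schurNum (glue μ ν (n + n)) (doubled t x) := by
  have e := ldet_reverse (sepKernel t x y) (sepRows n i ++ sepRows n (t - 1 - i))
    (partClass μ t i p) (partClass ν t (t - 1 - i) q) []
  rw [List.append_nil, List.append_nil, length_partClass] at e
  rw [e, partClass_append_reverse μ ν t i h, sepRows_append, ldet_ofFn]
  have e2 : (Matrix.of fun r j : Fin (n + n) => sepKernel t x y
      (Fin.append (fun b : Fin n => some (i, b)) (fun b => some (t - 1 - i, b)) r)
      (pairCol μ ν t i p q (n + n) j)) =
      Matrix.of fun r j => pairCoeff i x r *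
        Matrix.of (fun r j => pairEntry μ ν p q (n + n) (doubled t x r) j) r j := by
    ext r j
    refine Fin.addCases (fun b => ?_) (fun b => ?_) r
    · simp only [Matrix.of_apply, Fin.append_left, pairCoeff, doubled]
      exact sepKernel_pairCol_left h hμ hν hi x y hx b j
    · simp only [Matrix.of_apply, Fin.append_right, pairCoeff, doubled]
      exact sepKernel_pairCol_right h hμ hν hi x y hx b j
  rw [e2, Matrix.det_mul_column, prod_pairCoeff i hx, det_pairEntry μ ν h _ (doubled_ne_zero t hx),
    prod_doubled t hx, inv_one, one_pow, Nat.choose_succ_succ' q 1, Nat.choose_one_right, pow_add]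
  ring

theorem det_snoc_linear {N : ℕ} (A : Fin N → Fin (N + 1) → K) (u v : Fin (N + 1) → K) (c d : K) :
    (Matrix.of (Fin.snoc (α := fun _ => Fin (N + 1) → K) A (c • u - d • v))).det =
      c * (Matrix.of (Fin.snoc (α := fun _ => Fin (N + 1) → K) A u)).det -
      d * (Matrix.of (Fin.snoc (α := fun _ => Fin (N + 1) → K) A v)).det := by
  have key : ∀ w : Fin (N + 1) → K, Matrix.of (Fin.snoc (α := fun _ => Fin (N + 1) → K) A w) =
      Matrix.updateRow (Matrix.of (Fin.snoc (α := fun _ => Fin (N + 1) → K) A 0))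
        (Fin.last N) w := by
    intro w
    exact (Fin.update_snoc_last (α := fun _ => Fin (N + 1) → K) _ _ _).symm
  rw [key, sub_eq_add_neg, ← neg_smul, Matrix.det_updateRow_add, Matrix.det_updateRow_smul,
    Matrix.det_updateRow_smul, ← key, ← key]
  ring

/-- The row of y is a combination of one row in y^t and one in y^(-t), so linearity gives two Schur
numerators. Now the product of the variables is y^t or y^(-t) instead of 1, which leaves a power of
y in front of each. -/
theorem ldet_pairBlock_last {μ ν : YoungDiagram} {t i p q n : ℕ} (h : p + q = n + n + 1)
    (hμ : ∀ j, p ≤ j → μ.rowLen j = 0) (hν : ∀ j, q ≤ j → ν.rowLen j = 0)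
    (hi : 2 * i + 1 < t) {x : Fin n → K} {y : K} (hx : ∀ b, x b ≠ 0) (hy : y ≠ 0) :
    ldet (sepKernel t x y) (sepRows n i ++ (sepRows n (t - 1 - i) ++ [none]))
        (partClass μ t i p ++ partClass ν t (t - 1 - i) q) =
      ((-1) ^ n * ∏ b, x b) * (-1) ^ ((q + 1).choose 2) *
        (y ^ (i + 1) * (y⁻¹ ^ t) ^ (ν.rowLen 0 + q) * schurNum (glue μ ν (n + n + 1))
            (Fin.snoc (α := fun _ => K) (doubled t x) (y ^ t)) -
          y⁻¹ ^ i * (y ^ t) ^ (ν.rowLen 0 + q) * schurNum (glue μ ν (n + n + 1))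
            (Fin.snoc (α := fun _ => K) (doubled t x) (y⁻¹ ^ t))) := by
  have e := ldet_reverse (sepKernel t x y) (sepRows n i ++ (sepRows n (t - 1 - i) ++ [none]))
    (partClass μ t i p) (partClass ν t (t - 1 - i) q) []
  rw [List.append_nil, List.append_nil, length_partClass] at e
  have er : sepRows n i ++ (sepRows n (t - 1 - i) ++ [none]) =
      List.ofFn (Fin.snoc (α := fun _ => Option (ℕ × Fin n))
        (Fin.append (fun b : Fin n => some (i, b)) fun b => some (t - 1 - i, b)) none) := by
    rw [← List.append_assoc, sepRows_append, List.ofFn_succ']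
    simp
  rw [e, partClass_append_reverse μ ν t i h, er, ldet_ofFn]
  set g : Fin (n + n + 1) → K := Fin.snoc (α := fun _ => K) (pairCoeff i x) 1 with hg
  have e2 : (Matrix.of fun r j : Fin (n + n + 1) => sepKernel t x y
      (Fin.snoc (α := fun _ => Option (ℕ × Fin n)) (Fin.append (fun b : Fin n => some (i, b))
        (fun b => some (t - 1 - i, b))) none r) (pairCol μ ν t i p q (n + n + 1) j)) =
      Matrix.of fun r j => g r * Matrix.of (Fin.snoc (α := fun _ => Fin (n + n + 1) → K)
        (fun r => pairEntry μ ν p q (n + n + 1) (doubled t x r))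
        (y ^ (i + 1) • pairEntry μ ν p q (n + n + 1) (y ^ t) -
          y⁻¹ ^ i • pairEntry μ ν p q (n + n + 1) (y⁻¹ ^ t))) r j := by
    ext r j
    refine Fin.lastCases ?_ (fun r => Fin.addCases (fun b => ?_) (fun b => ?_) r) r
    · simp only [Matrix.of_apply, Fin.snoc_last, hg, one_mul]
      exact sepKernel_pairCol_last h hμ hν hi x y hy j
    · simp only [Matrix.of_apply, Fin.snoc_castSucc, Fin.append_left, pairCoeff, doubled, hg]
      exact sepKernel_pairCol_left h hμ hν hi x y hx b j
    · simp only [Matrix.of_apply, Fin.snoc_castSucc, Fin.append_right, pairCoeff, doubled, hg]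
      exact sepKernel_pairCol_right h hμ hν hi x y hx b j
  have hg' : ∏ r, g r = (-1) ^ n * ∏ b, x b := by
    rw [Fin.prod_univ_castSucc]
    simp [hg, prod_pairCoeff i hx]
  have hw : ∀ z : K, z ≠ 0 → ∀ r, (Fin.snoc (α := fun _ => K) (doubled t x) z :
      Fin (n + n + 1) → K) r ≠ 0 := by
    intro z hz r
    refine Fin.lastCases ?_ (fun r => ?_) r
    · simpa using hz
    · simpa using doubled_ne_zero t hx r
  have hp : ∀ z : K, ∏ r, (Fin.snoc (α := fun _ => K) (doubled t x) z :
      Fin (n + n + 1) → K) r = z := by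
    intro z
    rw [Fin.prod_univ_castSucc]
    simp [prod_doubled t hx]
  rw [e2, Matrix.det_mul_column, hg', det_snoc_linear, ← of_snoc (pairEntry μ ν p q (n + n + 1)),
    ← of_snoc (pairEntry μ ν p q (n + n + 1)),
    det_pairEntry μ ν h _ (hw _ (pow_ne_zero _ hy)),
    det_pairEntry μ ν h _ (hw _ (pow_ne_zero _ (inv_ne_zero hy))), hp, hp,
    Nat.choose_succ_succ' q 1, Nat.choose_one_right, pow_add, ← inv_pow, ← inv_pow, inv_inv]
  ring

/-- A residue with 2i+1 = t is its own partner, so both terms of the kernel survive; x^(-i) is their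
common factor because β+1+i = t(B+1). -/
theorem sepKernel_mid {t i n : ℕ} (hi : 2 * i + 1 = t) (x : Fin n → K) (y : K)
    (hx : ∀ b, x b ≠ 0) (b : Fin n) (B : ℕ) :
    sepKernel t x y (some (i, b)) (t * B + i) =
      (x b)⁻¹ ^ i * ((x b ^ t) ^ (B + 1) - (x b ^ t)⁻¹ ^ B) := by
  have := hx b
  have hm : (t * B + i) % t = i := by rw [Nat.mul_add_mod, Nat.mod_eq_of_lt (by omega)]
  rw [sepKernel, hm, if_pos rfl, if_pos (by omega), mul_sub]
  congr 1
  · rw [← pow_mul, show t * (B + 1) = (t * B + i + 1) + i by rw [mul_add, mul_one]; omega,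
      pow_add _ _ i, inv_pow]
    field_simp
  · rw [pow_add, ← inv_pow, ← pow_mul]
    ring

theorem sepKernel_mid_last {t i n : ℕ} (hi : 2 * i + 1 = t) (x : Fin n → K) {y : K}
    (hy : y ≠ 0) (B : ℕ) :
    sepKernel t x y none (t * B + i) =
      y⁻¹ ^ i * ((y ^ t) ^ (B + 1) - (y ^ t)⁻¹ ^ B) := by
  rw [sepKernel, mul_sub]
  congr 1
  · rw [← pow_mul, show t * (B + 1) = (t * B + i + 1) + i by rw [mul_add, mul_one]; omega,
      pow_add _ _ i, inv_pow]
    field_simp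
  · rw [pow_add, ← inv_pow, ← pow_mul]
    ring

theorem ldet_midBlock (μ : YoungDiagram) {t i n : ℕ} (hi : 2 * i + 1 = t) {x : Fin n → K} (y : K)
    (hx : ∀ b, x b ≠ 0) :
    ldet (sepKernel t x y) (sepRows n i) (partClass μ t i n) =
      (∏ b, (x b)⁻¹ ^ i) * ooNum (parts μ n) fun b => x b ^ t := by
  rw [sepRows, partClass, ldet_ofFn, ooNum, ← Matrix.det_mul_column]
  congr 1
  ext b j
  exact sepKernel_mid hi x y hx b _

theorem ldet_midBlock_last (μ : YoungDiagram) {t i n : ℕ} (hi : 2 * i + 1 = t) {x : Fin n → K}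
    {y : K} (hx : ∀ b, x b ≠ 0) (hy : y ≠ 0) :
    ldet (sepKernel t x y) (sepRows n i ++ [none]) (partClass μ t i (n + 1)) =
      (∏ b, (x b)⁻¹ ^ i) * y⁻¹ ^ i * ooNum (parts μ (n + 1))
        (Fin.snoc (α := fun _ => K) (fun b => x b ^ t) (y ^ t)) := by
  have er : sepRows n i ++ [none] = List.ofFn (Fin.snoc (α := fun _ => Option (ℕ × Fin n))
        (fun b : Fin n => some (i, b)) none) := by
    rw [List.ofFn_succ', sepRows]
    simp
  have hp : (∏ b, (x b)⁻¹ ^ i) * y⁻¹ ^ i =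
      ∏ r : Fin (n + 1), Fin.snoc (α := fun _ => K) (fun b => (x b)⁻¹ ^ i) (y⁻¹ ^ i) r := by
    rw [Fin.prod_univ_castSucc]
    simp
  rw [er, partClass, ldet_ofFn, ooNum, hp, ← Matrix.det_mul_column]
  congr 1
  ext r j
  refine Fin.lastCases ?_ (fun b => ?_) r
  · simp only [Matrix.of_apply, Fin.snoc_last]
    exact sepKernel_mid_last hi x hy _
  · simp only [Matrix.of_apply, Fin.snoc_castSucc]
    exact sepKernel_mid hi x y hx b _

end Blocks

end OddOrthFactor
namespace OddOrthFactor

/-! ### Beta-sets, quotients and the empty partition -/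

section BetaSets

theorem beta_strictAnti (μ : YoungDiagram) (ℓ : ℕ) : StrictAnti (beta μ ℓ) := by
  intro i j hij
  have h1 := μ.rowLen_anti (i : ℕ) j (le_of_lt hij)
  have h2 : (i : ℕ) < j := hij
  have := j.isLt
  simp only [beta]
  omega

theorem card_betaSet (μ : YoungDiagram) (ℓ : ℕ) : (betaSet μ ℓ).card = ℓ := by
  rw [betaSet, Finset.card_image_of_injective _ (beta_strictAnti μ ℓ).injective]
  simp

theorem sum_resCount (μ : YoungDiagram) {t : ℕ} (ht : 0 < t) (ℓ : ℕ) :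
    ∑ i ∈ Finset.range t, resCount μ t ℓ i = ℓ := by
  conv_rhs => rw [← card_betaSet μ ℓ]
  rw [Finset.card_eq_sum_card_fiberwise (f := (· % t)) (t := Finset.range t)]
  · rfl
  · intro b _
    simpa using Nat.mod_lt b ht

theorem rowLen_ofBetaSet (B : Finset ℕ) {j : ℕ} (hj : j < B.card) :
    (ofBetaSet B).rowLen j =
      B.orderEmbOfFin rfl (Fin.rev ⟨j, hj⟩) - ((Fin.rev ⟨j, hj⟩ : Fin B.card) : ℕ) := by
  rw [ofBetaSet]
  have := YoungDiagram.rowLen_ofRowLens (w := List.ofFn fun i : Fin B.card =>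
    B.orderEmbOfFin rfl i.rev - (i.rev : ℕ)) (hw := by
      apply List.sortedGE_ofFn_iff.2
      intro i j hij
      exact sub_index_mono _ (B.orderEmbOfFin rfl).strictMono (Fin.rev_le_rev.2 hij))
      ⟨j, by simpa using hj⟩
  simp only at this
  rw [this]
  simp

theorem rowLen_ofBetaSet_of_le (B : Finset ℕ) {j : ℕ} (hj : B.card ≤ j) :
    (ofBetaSet B).rowLen j = 0 := by
  by_contra h
  have h1 : (j, 0) ∈ ofBetaSet B := YoungDiagram.mem_iff_lt_rowLen.2 (Nat.pos_of_ne_zero h)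
  rw [ofBetaSet, YoungDiagram.mem_ofRowLens] at h1
  obtain ⟨h2, _⟩ := h1
  simp at h2
  omega

/-- This makes the truncated subtraction in `ofBetaSet` exact. -/
theorem le_orderEmbOfFin (B : Finset ℕ) (j : Fin B.card) : (j : ℕ) ≤ B.orderEmbOfFin rfl j := by
  have := sub_index_mono _ (B.orderEmbOfFin rfl).strictMono
  obtain ⟨j, hj⟩ := j
  induction j with
  | zero => exact Nat.zero_le _
  | succ k ih =>
    have h1 := ih (by omega)
    have h2 : B.orderEmbOfFin rfl ⟨k, by omega⟩ < B.orderEmbOfFin rfl ⟨k + 1, hj⟩ :=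
      (B.orderEmbOfFin rfl).strictMono (by simp [Fin.lt_def])
    simp only at h1 ⊢
    omega

theorem beta_ofBetaSet (B : Finset ℕ) (j : Fin B.card) :
    beta (ofBetaSet B) B.card j = B.orderEmbOfFin rfl j.rev := by
  rw [beta, rowLen_ofBetaSet B j.isLt]
  have := le_orderEmbOfFin B j.rev
  simp only [Fin.eta]
  rw [Fin.val_rev] at *
  omega

theorem betaSet_ofBetaSet (B : Finset ℕ) : betaSet (ofBetaSet B) B.card = B := by
  ext c
  simp only [betaSet, Finset.mem_image, Finset.mem_univ, true_and, beta_ofBetaSet]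
  constructor
  · rintro ⟨j, rfl⟩
    exact Finset.orderEmbOfFin_mem _ _ _
  · intro hc
    have : c ∈ Set.range (B.orderEmbOfFin rfl) := by rw [Finset.range_orderEmbOfFin]; exact hc
    obtain ⟨j, rfl⟩ := this
    exact ⟨j.rev, by simp⟩

theorem eq_ofFn_beta_of_pairwise {l : List ℕ} (hl : l.Pairwise (· > ·)) {B : Finset ℕ}
    (hB : ∀ c, c ∈ l ↔ c ∈ B) : l = List.ofFn (beta (ofBetaSet B) B.card) := by
  have h2 : (List.ofFn (beta (ofBetaSet B) B.card)).Pairwise (· > ·) := by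
    rw [List.pairwise_ofFn]
    exact fun i j hij => beta_strictAnti _ _ hij
  refine List.Perm.eq_of_pairwise (le := (· > ·))
    (fun a b _ _ h h' => (lt_asymm h h').elim) hl h2 ?_
  rw [List.perm_ext_iff_of_nodup (hl.imp ne_of_gt) (h2.imp ne_of_gt)]
  intro c
  rw [hB]
  conv_lhs => rw [← betaSet_ofBetaSet B]
  simp [betaSet, List.mem_ofFn]

theorem mem_betaSet {μ : YoungDiagram} {ℓ c : ℕ} : c ∈ betaSet μ ℓ ↔ ∃ j, beta μ ℓ j = c := by
  simp [betaSet]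

theorem card_quotient_beta (μ : YoungDiagram) (t ℓ i : ℕ) :
    (((betaSet μ ℓ).filter (fun b => b % t = i)).image (fun b => b / t)).card =
      resCount μ t ℓ i := by
  rw [resCount, Finset.card_image_of_injOn]
  intro b hb c hc h
  simp only [Finset.coe_filter, Set.mem_ofPred_eq] at hb hc
  simp only at h
  rw [← Nat.mod_add_div b t, ← Nat.mod_add_div c t, hb.2, hc.2, h]

theorem rowLen_quo_of_le (μ : YoungDiagram) (t ℓ i : ℕ) {j : ℕ} (hj : resCount μ t ℓ i ≤ j) :
    (quo μ t ℓ i).rowLen j = 0 := by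
  rw [← card_quotient_beta] at hj
  exact rowLen_ofBetaSet_of_le _ hj

/-- Division by t is strictly increasing on a residue class, so it turns the class into the
decreasing list of the beta-set defining the quotient component. -/
theorem resClass_beta (μ : YoungDiagram) (t ℓ i : ℕ) :
    resClass (beta μ ℓ) t i = partClass (quo μ t ℓ i) t i (resCount μ t ℓ i) := by
  set B := ((betaSet μ ℓ).filter (fun b => b % t = i)).image (fun b => b / t) with hB
  have hp := pairwise_resClass (beta_strictAnti μ ℓ) t i
  have hdm : ∀ c ∈ resClass (beta μ ℓ) t i, t * (c / t) + i = c := by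
    intro c hc
    rw [mem_resClass] at hc
    rw [← hc.2]
    exact Nat.div_add_mod c t
  have h1 : (resClass (beta μ ℓ) t i).map (· / t) = List.ofFn (beta (ofBetaSet B) B.card) := by
    apply eq_ofFn_beta_of_pairwise
    · rw [List.pairwise_map]
      refine hp.imp_of_mem fun {a b} ha hb hab => ?_
      rw [← hdm a ha, ← hdm b hb] at hab
      by_contra hle
      have := Nat.mul_le_mul_left t (not_lt.1 hle)
      omega
    · intro c
      simp only [List.mem_map, hB, Finset.mem_image, Finset.mem_filter, mem_resClass, mem_betaSet]
  have h2 : resClass (beta μ ℓ) t i =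
      ((resClass (beta μ ℓ) t i).map (· / t)).map fun c => t * c + i := by
    rw [List.map_map]
    conv_lhs => rw [← List.map_id (resClass (beta μ ℓ) t i)]
    exact List.map_congr_left fun c hc => (hdm c hc).symm
  rw [h2, h1, List.map_ofFn, partClass]
  have hc : B.card = resCount μ t ℓ i := card_quotient_beta μ t ℓ i
  rw [← hc]
  rfl

theorem length_resClass_beta (μ : YoungDiagram) (t ℓ i : ℕ) :
    (resClass (beta μ ℓ) t i).length = resCount μ t ℓ i := by
  rw [resClass_beta, length_partClass]

theorem rowLen_bot (j : ℕ) : (⊥ : YoungDiagram).rowLen j = 0 := by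
  by_contra h
  exact YoungDiagram.notMem_bot _ (YoungDiagram.mem_iff_lt_rowLen.2 (Nat.pos_of_ne_zero h))

theorem betaSet_bot (ℓ : ℕ) : betaSet ⊥ ℓ = Finset.range ℓ := by
  ext c
  simp only [mem_betaSet, beta, rowLen_bot, zero_add, Finset.mem_range]
  constructor
  · rintro ⟨j, rfl⟩
    have := j.isLt
    omega
  · intro hc
    exact ⟨⟨ℓ - 1 - c, by omega⟩, by simp only; omega⟩

theorem rowLen_ofBetaSet_range (m j : ℕ) : (ofBetaSet (Finset.range m)).rowLen j = 0 := by
  rcases Nat.lt_or_ge j (Finset.range m).card with hj | hj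
  · rw [rowLen_ofBetaSet _ hj]
    have h1 : (Finset.range m).orderEmbOfFin rfl =
        Fin.valOrderEmb (Finset.range m).card := by
      symm
      apply Finset.orderEmbOfFin_unique'
      intro x
      have := x.isLt
      simpa using this
    rw [h1]
    simp
  · exact rowLen_ofBetaSet_of_le _ hj

/-- The beta-numbers of the empty partition are 0, ..., tn; the last one gives residue 0 its
additional member. -/
theorem quotient_beta_bot {t n i : ℕ} (hi : i < t) :
    ((betaSet ⊥ (t * n + 1)).filter (fun b => b % t = i)).image (fun b => b / t) =
      Finset.range (n + if i = 0 then 1 else 0) := by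
  ext c
  simp only [betaSet_bot, Finset.mem_image, Finset.mem_filter, Finset.mem_range]
  constructor
  · rintro ⟨b, ⟨h1, h2⟩, rfl⟩
    split_ifs with h0
    · have : b / t ≤ n := by
        rw [Nat.div_le_iff_le_mul_add_pred (by omega)]
        omega
      omega
    · rw [add_zero, Nat.div_lt_iff_lt_mul (by omega)]
      have : b ≠ t * n := by
        rintro rfl
        rw [Nat.mul_mod_right] at h2
        omega
      rw [mul_comm n t]
      omega
  · intro hc
    refine ⟨t * c + i, ⟨?_, ?_⟩, ?_⟩
    · split_ifs at hc with h0
      · have := Nat.mul_le_mul_left t (Nat.lt_succ_iff.1 hc)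
        omega
      · have := Nat.mul_le_mul_left t (show c + 1 ≤ n from hc)
        rw [mul_add, mul_one] at this
        omega
    · rw [Nat.mul_add_mod, Nat.mod_eq_of_lt hi]
    · rw [Nat.mul_add_div (by omega), Nat.div_eq_of_lt hi, add_zero]

theorem resCount_bot {t n i : ℕ} (hi : i < t) :
    resCount ⊥ t (t * n + 1) i = n + if i = 0 then 1 else 0 := by
  rw [← card_quotient_beta, quotient_beta_bot hi, Finset.card_range]

theorem rowLen_quo_bot {t n i : ℕ} (hi : i < t) (j : ℕ) :
    (quo ⊥ t (t * n + 1) i).rowLen j = 0 := by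
  rw [quo, quotient_beta_bot hi, rowLen_ofBetaSet_range]

end BetaSets

end OddOrthFactor
namespace OddOrthFactor

/-! ### The surplus column, and vanishing when a pair is deficient -/

section Middle

/-- Summed over all i < t, the excesses n_i + n_{t-1-i} - 2n are nonnegative with total 2(tn+1) -
2nt = 2. By symmetry the total is shared by i₀ and t-1-i₀, or carried by a self-paired i₀. -/
theorem exists_isMiddle {lam : YoungDiagram} {t n : ℕ} (ht : 0 < t)
    (h : ∀ i < t, 2 * n ≤ resCount lam t (t * n + 1) i + resCount lam t (t * n + 1) (t - 1 - i)) :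
    ∃ i₀, IsMiddle lam t n i₀ := by
  set c := resCount lam t (t * n + 1) with hc
  have hsum : ∑ i ∈ Finset.range t, (c i + c (t - 1 - i)) = 2 * n * t + 2 := by
    rw [Finset.sum_add_distrib, Finset.sum_range_reflect, sum_resCount lam ht]
    ring
  have hsum' : ∑ i ∈ Finset.range t, (c i + c (t - 1 - i) - 2 * n) = 2 := by
    have : ∑ i ∈ Finset.range t, (c i + c (t - 1 - i) - 2 * n) + ∑ i ∈ Finset.range t, 2 * n =
        2 * n * t + 2 := by
      rw [← Finset.sum_add_distrib, ← hsum]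
      refine Finset.sum_congr rfl fun i hi => ?_
      have := h i (Finset.mem_range.1 hi)
      omega
    rw [Finset.sum_const, Finset.card_range, smul_eq_mul, mul_comm t] at this
    omega
  obtain ⟨i, hi, hpos⟩ : ∃ i < t, 0 < c i + c (t - 1 - i) - 2 * n := by
    by_contra! hne
    rw [Finset.sum_eq_zero fun i hi => Nat.le_zero.1 (hne i (Finset.mem_range.1 hi))] at hsum'
    omega
  obtain ⟨i, hi, hi2, hpos⟩ : ∃ i < t, 2 * i < t ∧ 0 < c i + c (t - 1 - i) - 2 * n := by
    rcases Nat.lt_or_ge (2 * i) t with h2 | h2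
    · exact ⟨i, hi, h2, hpos⟩
    · refine ⟨t - 1 - i, by omega, by omega, ?_⟩
      rw [show t - 1 - (t - 1 - i) = i by omega, add_comm]
      exact hpos
  refine ⟨i, by omega, fun j hj => ?_⟩
  have hjt : j < t := by omega
  have hge := h j hjt
  change c j + c (t - 1 - j) = _
  have hsub : ∀ s ⊆ Finset.range t, ∑ i ∈ s, (c i + c (t - 1 - i) - 2 * n) ≤ 2 := fun s hs =>
    (Finset.sum_le_sum_of_subset hs).trans hsum'.le
  split_ifs with hji hmid
  -- For a self-paired index the excess is even, positive and at most 2, hence equal to 2.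
  · subst hji
    have e : t - 1 - j = j := by omega
    have h1 := hsub {j} (by simpa using hjt)
    rw [Finset.sum_singleton, e] at h1
    rw [e] at hpos ⊢
    omega
  · subst hji
    have h1 := hsub {j, t - 1 - j} (by
      intro k
      simp only [Finset.mem_insert, Finset.mem_singleton, Finset.mem_range]
      omega)
    rw [Finset.sum_pair (by omega), show t - 1 - (t - 1 - j) = j by omega] at h1
    omega
  · by_cases hmid : 2 * i + 1 = t
    · have e : t - 1 - i = i := by omega
      have h1 := hsub {j, i} (by
        intro k
        simp only [Finset.mem_insert, Finset.mem_singleton, Finset.mem_range]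
        omega)
      rw [Finset.sum_pair hji, e] at h1
      rw [e] at hpos
      omega
    · have h1 := hsub {j, i, t - 1 - i} (by
        intro k
        simp only [Finset.mem_insert, Finset.mem_singleton, Finset.mem_range]
        omega)
      rw [Finset.sum_insert (by simp only [Finset.mem_insert, Finset.mem_singleton]; omega),
        Finset.sum_pair (by omega), show t - 1 - (t - 1 - i) = i by omega] at h1
      omega

theorem IsMiddle.eq {lam : YoungDiagram} {t n i₀ i₁ : ℕ} (h₀ : IsMiddle lam t n i₀)
    (h₁ : IsMiddle lam t n i₁) : i₀ = i₁ := by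
  by_contra hne
  have e0 := h₀.2 i₀ h₀.1
  have e1 := h₁.2 i₀ h₀.1
  rw [if_pos rfl] at e0
  rw [if_neg hne] at e1
  omega

/-- By pigeonhole, every term of the Leibniz expansion matches some row of `R` with a column outside
`C`. -/
theorem det_eq_zero_of_card_lt {K : Type*} [Field K] {N : ℕ} (M : Matrix (Fin N) (Fin N) K)
    (R C : Finset (Fin N)) (hcard : C.card < R.card) (h0 : ∀ r ∈ R, ∀ c ∉ C, M r c = 0) :
    M.det = 0 := by
  rw [Matrix.det_apply]
  refine Finset.sum_eq_zero fun σ _ => ?_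
  obtain ⟨r, hr, hrC⟩ : ∃ r ∈ R, σ.symm r ∉ C := by
    by_contra! hne
    have := Finset.card_le_card_of_injOn σ.symm hne σ.symm.injective.injOn
    omega
  rw [Finset.prod_eq_zero (Finset.mem_univ (σ.symm r)), smul_zero]
  rw [Equiv.apply_symm_apply]
  exact h0 r hr _ hrC

theorem card_filter_beta_mod (μ : YoungDiagram) (t ℓ i : ℕ) :
    (Finset.univ.filter fun j => beta μ ℓ j % t = i).card = resCount μ t ℓ i := by
  rw [resCount, betaSet, Finset.filter_image,
    Finset.card_image_of_injective _ (beta_strictAnti μ ℓ).injective]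

theorem det_sepKernel_eq_zero {K : Type*} [Field K] {t n : ℕ} (x : Fin n → K) (y : K)
    (lam : YoungDiagram) {i : ℕ} (hi : i < t)
    (h : resCount lam t (t * n + 1) i + resCount lam t (t * n + 1) (t - 1 - i) < 2 * n) :
    (Matrix.of fun r j => sepKernel t x y (allRows t n r) (beta lam (t * n + 1) j)).det = 0 := by
  have hi' : t - 1 - i < t := by omega
  set I : Finset (Fin t) := {⟨i, hi⟩, ⟨t - 1 - i, hi'⟩} with hI
  have hinj : Function.Injective fun p : Fin t × Fin n => (finProdFinEquiv p).castSucc :=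
    (Fin.castSucc_injective _).comp finProdFinEquiv.injective
  refine det_eq_zero_of_card_lt _
    ((I ×ˢ (Finset.univ : Finset (Fin n))).image fun p => (finProdFinEquiv p).castSucc)
    (Finset.univ.filter (fun j => beta lam (t * n + 1) j % t = i) ∪
      Finset.univ.filter fun j => beta lam (t * n + 1) j % t = t - 1 - i) ?_ ?_
  · rw [Finset.card_image_of_injective _ hinj, Finset.card_product, Finset.card_univ,
      Fintype.card_fin]
    by_cases hm : 2 * i + 1 = t
    · have e : t - 1 - i = i := by omega
      have hI1 : I.card = 1 := by simp [hI, e]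
      rw [e] at h ⊢
      rw [Finset.union_self, card_filter_beta_mod, hI1]
      omega
    · have hI2 : I.card = 2 := Finset.card_pair (by simp only [ne_eq, Fin.mk.injEq]; omega)
      refine (Finset.card_union_le _ _).trans_lt ?_
      rw [card_filter_beta_mod, card_filter_beta_mod, hI2]
      exact h
  · intro r hr c hc
    simp only [Finset.mem_image, Finset.mem_product, hI, Finset.mem_insert,
      Finset.mem_singleton, Finset.mem_univ, and_true] at hr
    simp only [Finset.mem_union, Finset.mem_filter, Finset.mem_univ, true_and, not_or] at hc
    obtain ⟨⟨k, b⟩, hk, rfl⟩ := hr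
    rw [Matrix.of_apply, allRows, Fin.snoc_castSucc, Equiv.symm_apply_apply]
    rcases hk with rfl | rfl
    · rw [sepKernel, if_neg hc.1, if_neg (by simp only; omega), sub_zero]
    · rw [sepKernel, if_neg hc.2, if_neg (by simp only; omega), sub_zero]

end Middle

/-! ### Frobenius coordinates read off from beta-sets -/

section Frobenius

theorem lt_rank_iff (μ : YoungDiagram) (i : ℕ) : i < rank μ ↔ (i, i) ∈ μ := by
  classical
  have hex : ∃ i, (i, i) ∉ μ := by
    obtain ⟨j, hj⟩ := YoungDiagram.exists_notMem_row μ 0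
    exact ⟨j, fun h => hj (μ.up_left_mem (Nat.zero_le _) le_rfl h)⟩
  have hD : μ.cells.filter (fun c => c.1 = c.2) =
      (Finset.range (Nat.find hex)).image fun i => (i, i) := by
    ext ⟨a, b⟩
    simp only [Finset.mem_filter, YoungDiagram.mem_cells, Finset.mem_image, Finset.mem_range,
      Prod.mk.injEq]
    constructor
    · rintro ⟨h, rfl⟩
      refine ⟨a, ?_, rfl, rfl⟩
      by_contra hle
      exact Nat.find_spec hex (μ.up_left_mem (not_lt.1 hle) (not_lt.1 hle) h)
    · rintro ⟨c, hc, rfl, rfl⟩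
      exact ⟨not_not.1 (Nat.find_min hex hc), rfl⟩
  have hr : rank μ = Nat.find hex := by
    rw [rank, hD, Finset.card_image_of_injective, Finset.card_range]
    intro a b h
    exact (Prod.mk.inj h).1
  rw [hr]
  constructor
  · exact fun h => not_not.1 (Nat.find_min hex h)
  · intro h
    by_contra hle
    exact Nat.find_spec hex (μ.up_left_mem (not_lt.1 hle) (not_lt.1 hle) h)

theorem mem_arms_iff {μ : YoungDiagram} {ℓ : ℕ} (hℓ : μ.colLen 0 ≤ ℓ) (a : ℕ) :
    a ∈ arms μ ↔ a + ℓ ∈ betaSet μ ℓ := by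
  simp only [arms, List.mem_map, List.mem_range, mem_betaSet, lt_rank_iff]
  constructor
  · rintro ⟨i, hi, rfl⟩
    have h1 := YoungDiagram.mem_iff_lt_rowLen.1 hi
    have h2 := YoungDiagram.mem_iff_lt_colLen.1 hi
    have h3 := μ.colLen_anti 0 i (Nat.zero_le _)
    refine ⟨⟨i, by omega⟩, ?_⟩
    simp only [beta]
    omega
  · rintro ⟨j, hj⟩
    simp only [beta] at hj
    have := j.isLt
    exact ⟨j, YoungDiagram.mem_iff_lt_rowLen.2 (by omega), by omega⟩

/-- Each gap of the beta-set below ℓ corresponds to a column that reaches below the diagonal. -/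
theorem mem_legs_iff {μ : YoungDiagram} {ℓ : ℕ} (hℓ : μ.colLen 0 ≤ ℓ) (g : ℕ) :
    g ∈ legs μ ↔ g < ℓ ∧ ℓ - 1 - g ∉ betaSet μ ℓ := by
  classical
  simp only [legs, List.mem_map, List.mem_range, mem_betaSet, lt_rank_iff]
  constructor
  · rintro ⟨j, hj, rfl⟩
    have h2 := YoungDiagram.mem_iff_lt_colLen.1 hj
    have h3 := μ.colLen_anti 0 j (Nat.zero_le _)
    refine ⟨by omega, ?_⟩
    rintro ⟨i, hi⟩
    simp only [beta] at hi
    have hi' := i.isLt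
    by_cases hc : (i : ℕ) < μ.colLen j
    · have := YoungDiagram.mem_iff_lt_rowLen.1 (YoungDiagram.mem_iff_lt_colLen.2 hc)
      omega
    · have : ¬ j < μ.rowLen i := fun h =>
        hc (YoungDiagram.mem_iff_lt_colLen.1 (YoungDiagram.mem_iff_lt_rowLen.2 h))
      omega
  · rintro ⟨hg, hB⟩
    have hB' : ∀ i < ℓ, μ.rowLen i + (ℓ - 1 - i) ≠ ℓ - 1 - g := fun i hi h => hB ⟨⟨i, hi⟩, h⟩
    -- k is the number of rows whose beta-number exceeds the gap; the column sought has index k-1-g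
    -- and length k.
    have hex : ∃ k, k = ℓ ∨ k < ℓ ∧ μ.rowLen k + (ℓ - 1 - k) < ℓ - 1 - g := ⟨ℓ, Or.inl rfl⟩
    set k := Nat.find hex with hk
    have hk1 : k = ℓ ∨ k < ℓ ∧ μ.rowLen k + (ℓ - 1 - k) < ℓ - 1 - g := Nat.find_spec hex
    have hkl : k ≤ ℓ := by omega
    have hk2 : ∀ i < k, ℓ - 1 - g < μ.rowLen i + (ℓ - 1 - i) := by
      intro i hi
      have h1 := Nat.find_min hex hi
      have h2 := hB' i (by omega)
      omega
    have hgk : g + 1 ≤ k := by omega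
    have hrow : μ.rowLen k ≤ k - 1 - g := by
      rcases hk1 with h | h
      · have : ¬ 0 < μ.rowLen k := fun h0 => by
          have := YoungDiagram.mem_iff_lt_colLen.1 (YoungDiagram.mem_iff_lt_rowLen.2 h0)
          omega
        omega
      · omega
    have hcol : μ.colLen (k - 1 - g) = k := by
      apply le_antisymm
      · by_contra hlt
        have := YoungDiagram.mem_iff_lt_rowLen.1
          (YoungDiagram.mem_iff_lt_colLen.2 (not_le.1 hlt))
        omega
      · have h1 := hk2 (k - 1) (by omega)
        have := YoungDiagram.mem_iff_lt_colLen.1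
          (YoungDiagram.mem_iff_lt_rowLen.2 (show k - 1 - g < μ.rowLen (k - 1) by omega))
        omega
    exact ⟨k - 1 - g, YoungDiagram.mem_iff_lt_colLen.2 (by omega), by omega⟩

theorem pairwise_arms (μ : YoungDiagram) : (arms μ).Pairwise (· > ·) := by
  rw [arms, List.pairwise_map]
  refine List.pairwise_lt_range.imp_of_mem fun {i j} hi hj hij => ?_
  rw [List.mem_range, lt_rank_iff, YoungDiagram.mem_iff_lt_rowLen] at hi hj
  have := μ.rowLen_anti i j hij.le
  omega

theorem pairwise_legs (μ : YoungDiagram) : (legs μ).Pairwise (· > ·) := by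
  rw [legs, List.pairwise_map]
  refine List.pairwise_lt_range.imp_of_mem fun {i j} hi hj hij => ?_
  rw [List.mem_range, lt_rank_iff, YoungDiagram.mem_iff_lt_colLen] at hi hj
  have := μ.colLen_anti i j hij.le
  omega

@[simp] theorem length_arms (μ : YoungDiagram) : (arms μ).length = rank μ := by simp [arms]

@[simp] theorem length_legs (μ : YoungDiagram) : (legs μ).length = rank μ := by simp [legs]

theorem eq_of_pairwise_gt_of_subset {l l' : List ℕ} (h : l.Pairwise (· > ·))
    (h' : l'.Pairwise (· > ·)) (hsub : l ⊆ l') (hlen : l'.length ≤ l.length) : l = l' :=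
  List.Perm.eq_of_pairwise (le := (· > ·)) (fun _ _ _ _ hab hba => (lt_asymm hab hba).elim) h h'
    ((List.subperm_of_subset (h.imp ne_of_gt) hsub).perm_of_length_le hlen)

/-- Legs and shifted arms are strictly decreasing lists of equal length, so an equality of lists
reduces to an inclusion of their entries. -/
theorem exists_isAsymmetric_iff (μ : YoungDiagram) :
    (∃ k, IsAsymmetric 2 0 k μ ∨ IsAsymmetric 2 1 k μ) ↔
      (∃ z < 2, ∀ g ∈ legs μ, g = z ∨ ∃ a ∈ arms μ, g = a + 2) := by
  have hmap : ((arms μ).map (· + 2)).Pairwise (· > ·) := by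
    rw [List.pairwise_map]
    exact (pairwise_arms μ).imp fun h => Nat.add_lt_add_right h 2
  constructor
  · have key : ∀ z < 2, ∀ k, IsAsymmetric 2 z k μ →
        ∃ z < 2, ∀ g ∈ legs μ, g = z ∨ ∃ a ∈ arms μ, g = a + 2 := by
      rintro z hz k ⟨_, hk⟩
      refine ⟨z, hz, fun g hg => ?_⟩
      rw [hk] at hg
      split_ifs at hg
      · right
        simpa [eq_comm] using hg
      · rw [List.mem_append, List.mem_singleton] at hg
        rcases hg with hg | hg
        · right
          simpa [eq_comm] using List.mem_of_mem_eraseIdx hg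
        · exact Or.inl hg
    rintro ⟨k, h | h⟩
    · exact key 0 (by omega) k h
    · exact key 1 (by omega) k h
  · rintro ⟨z, hz, h⟩
    by_cases hzl : z ∈ legs μ
    · have hlt : ∃ k, k < rank μ ∧ legs μ = ((arms μ).map (· + 2)).eraseIdx k ++ [z] := by
        -- If every shifted arm were a leg, the two lists would agree; but z < 2 is a leg and no
        -- shifted arm. The position of the missing entry is the k to omit.
        obtain ⟨c, hc, hcl⟩ : ∃ c ∈ (arms μ).map (· + 2), c ∉ legs μ := by
          by_contra! hne
          have := eq_of_pairwise_gt_of_subset hmap (pairwise_legs μ) hne (by simp)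
          rw [← this] at hzl
          simp only [List.mem_map] at hzl
          obtain ⟨a, _, ha⟩ := hzl
          omega
        obtain ⟨k, hk, rfl⟩ := List.getElem_of_mem hc
        refine ⟨k, by simpa using hk, ?_⟩
        apply eq_of_pairwise_gt_of_subset (pairwise_legs μ)
        · rw [List.pairwise_append]
          refine ⟨hmap.sublist (List.eraseIdx_sublist _ _), by simp, fun a ha b hb => ?_⟩
          rw [List.mem_singleton] at hb
          have := List.mem_of_mem_eraseIdx ha
          simp only [List.mem_map] at this
          obtain ⟨a', _, ha'⟩ := this
          omega
        · intro g hg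
          rw [List.mem_append, List.mem_singleton]
          rcases h g hg with rfl | ⟨a, ha, rfl⟩
          · exact Or.inr rfl
          · left
            have ham : a + 2 ∈ (arms μ).map (· + 2) := List.mem_map_of_mem ha
            obtain ⟨i, hi, hia⟩ := List.getElem_of_mem ham
            rw [List.mem_eraseIdx_iff_getElem]
            refine ⟨i, hi, ?_, hia⟩
            rintro rfl
            exact hcl (hia ▸ hg)
        · rw [List.length_append, List.length_eraseIdx_of_lt hk]
          simp only [List.length_map, length_arms, length_legs, List.length_singleton] at hk ⊢
          omega
      obtain ⟨k, hk, hkl⟩ := hlt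
      have : IsAsymmetric 2 z (k + 1) μ := ⟨hk, by simpa using hkl⟩
      refine ⟨k + 1, ?_⟩
      interval_cases z
      · exact Or.inl this
      · exact Or.inr this
    · refine ⟨0, Or.inl ⟨Nat.zero_le _, ?_⟩⟩
      rw [if_pos rfl]
      refine eq_of_pairwise_gt_of_subset (pairwise_legs μ) hmap (fun g hg => ?_) (by simp)
      rcases h g hg with rfl | ⟨a, ha, rfl⟩
      · exact (hzl hg).elim
      · exact List.mem_map_of_mem ha

end Frobenius

end OddOrthFactor
namespace OddOrthFactor

/-! ### Asymmetry of the core as a condition on residue counts -/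

section Core

/-- The beta-set that defines the core. -/
def coreSet (μ : YoungDiagram) (t ℓ : ℕ) : Finset ℕ :=
  (Finset.range t).biUnion fun i => (Finset.range (resCount μ t ℓ i)).image fun j => t * j + i

theorem mem_coreSet {μ : YoungDiagram} {t ℓ j i : ℕ} (hi : i < t) :
    t * j + i ∈ coreSet μ t ℓ ↔ j < resCount μ t ℓ i := by
  simp only [coreSet, Finset.mem_biUnion, Finset.mem_range, Finset.mem_image]
  constructor
  · rintro ⟨i', hi', j', hj', h⟩
    have h1 := congrArg (· % t) h
    have h2 := congrArg (· / t) h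
    simp only [Nat.mul_add_mod, Nat.mod_eq_of_lt hi, Nat.mod_eq_of_lt hi'] at h1
    simp only [Nat.mul_add_div (show 0 < t by omega), Nat.div_eq_of_lt hi,
      Nat.div_eq_of_lt hi', add_zero] at h2
    rw [← h1, ← h2]
    exact hj'
  · exact fun h => ⟨i, hi, j, h, rfl⟩

theorem card_coreSet (μ : YoungDiagram) {t : ℕ} (ht : 0 < t) (ℓ : ℕ) :
    (coreSet μ t ℓ).card = ℓ := by
  rw [coreSet, Finset.card_biUnion]
  · refine Eq.trans ?_ (sum_resCount μ ht ℓ)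
    refine Finset.sum_congr rfl fun i _ => ?_
    rw [Finset.card_image_of_injective, Finset.card_range]
    intro a b h
    exact Nat.eq_of_mul_eq_mul_left ht (Nat.add_right_cancel h)
  · intro i hi j hj hij
    rw [Function.onFun, Finset.disjoint_left]
    intro c hc hc'
    simp only [Finset.mem_image] at hc hc'
    rw [Finset.mem_coe, Finset.mem_range] at hi hj
    obtain ⟨a, _, rfl⟩ := hc
    obtain ⟨b, _, h⟩ := hc'
    have h1 := congrArg (· % t) h
    simp only [Nat.mul_add_mod] at h1
    rw [Nat.mod_eq_of_lt hi, Nat.mod_eq_of_lt hj] at h1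
    exact hij h1.symm

theorem betaSet_core (μ : YoungDiagram) {t : ℕ} (ht : 0 < t) (ℓ : ℕ) :
    betaSet (core μ t ℓ) ℓ = coreSet μ t ℓ := by
  conv_lhs => rw [← card_coreSet μ ht ℓ]
  rw [core, card_coreSet μ ht ℓ]
  have := betaSet_ofBetaSet (coreSet μ t ℓ)
  rw [card_coreSet μ ht ℓ] at this
  exact this

theorem colLen_core_le (μ : YoungDiagram) {t : ℕ} (ht : 0 < t) (ℓ : ℕ) :
    (core μ t ℓ).colLen 0 ≤ ℓ := by
  by_contra h
  have h1 := YoungDiagram.mem_iff_lt_rowLen.1 (YoungDiagram.mem_iff_lt_colLen.2 (not_le.1 h))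
  have h2 : (core μ t ℓ).rowLen ℓ = 0 :=
    rowLen_ofBetaSet_of_le (coreSet μ t ℓ) (card_coreSet μ ht ℓ).le
  omega

theorem reflect_decomposition {t n j i c : ℕ} (hi : i < t) (hj : j < 2 * n) (hc : t * j + i = c) :
    t * (2 * n - 1 - j) + (t - 1 - i) + c + 1 = 2 * (t * n) := by
  obtain ⟨m, hm⟩ := Nat.exists_eq_add_of_lt hj
  rw [show 2 * n - 1 - j = m by omega, ← hc]
  have : 2 * (t * n) = t * (2 * n) := by ring
  rw [this, hm]
  have : t * (j + m + 1) = t * j + t * m + t := by ring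
  omega

/-- On each residue class the core fills the lowest positions. So n_i + n_{t-1-i} < 2n holds exactly
when some position and its reflection under c ↦ 2tn-1-c are both gaps. -/
theorem exists_isAsymmetric_core_iff (μ : YoungDiagram) {t : ℕ} (ht : 0 < t) (n : ℕ) :
    (∃ k, IsAsymmetric 2 0 k (core μ t (t * n + 1)) ∨
      IsAsymmetric 2 1 k (core μ t (t * n + 1))) ↔
    ∀ i < t, 2 * n ≤ resCount μ t (t * n + 1) i + resCount μ t (t * n + 1) (t - 1 - i) := by
  rw [exists_isAsymmetric_iff]
  have hℓ := colLen_core_le μ ht (t * n + 1)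
  have hB := betaSet_core μ ht (t * n + 1)
  simp only [mem_legs_iff hℓ, mem_arms_iff hℓ, hB]
  set B := coreSet μ t (t * n + 1) with hBdef
  set N := resCount μ t (t * n + 1) with hN
  constructor
  · rintro ⟨z, hz, h⟩ i hi
    by_contra hlt
    have hi' : t - 1 - i < t := by omega
    have h1 : t * N i + i ∉ B := by rw [hBdef, mem_coreSet hi]; exact lt_irrefl _
    have h2 : t * (2 * n - 1 - N i) + (t - 1 - i) ∉ B := by
      rw [hBdef, mem_coreSet hi']
      change ¬ _ < N (t - 1 - i)
      omega
    have hsum := reflect_decomposition (n := n) (j := N i) hi (by omega) rfl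
    -- The smaller gap c gives a leg tn-c ≥ 1, whose arm would sit at c'. So this leg must be z = 1,
    -- whence c' = tn is the gap of a leg 0, which is neither z nor a shifted arm.
    have key : ∀ c c', c ∉ B → c' ∉ B → c + c' + 1 = 2 * (t * n) → ¬ c ≤ c' := by
      intro c c' hc hc' hcc hle
      have e1 := h (t * n - c) ⟨by omega, by
        rwa [show t * n + 1 - 1 - (t * n - c) = c by omega]⟩
      rcases e1 with e1 | ⟨a, ha, hae⟩
      · have e2 := h (t * n - c') ⟨by omega, by
          rwa [show t * n + 1 - 1 - (t * n - c') = c' by omega]⟩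
        rcases e2 with e2 | ⟨a, ha, hae⟩
        · omega
        · omega
      · rw [show a + (t * n + 1) = c' by omega] at ha
        exact hc' ha
    rcases le_total (t * N i + i) (t * (2 * n - 1 - N i) + (t - 1 - i)) with hle | hle
    · exact key _ _ h1 h2 (by omega) hle
    · exact key _ _ h2 h1 (by omega) hle
  · intro h
    have key : ∀ c c', c ∉ B → c + c' + 1 = 2 * (t * n) → c' ∈ B := by
      intro c c' hc hcc
      have hm := Nat.mod_lt c ht
      have hd := Nat.div_add_mod c t
      have hm' : t - 1 - c % t < t := by omega
      rw [← hd, hBdef, mem_coreSet hm] at hc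
      change ¬ _ < N _ at hc
      have hj : c / t < 2 * n := by
        rw [Nat.div_lt_iff_lt_mul ht]
        have : 2 * n * t = 2 * (t * n) := by ring
        omega
      have e := reflect_decomposition (n := n) hm hj hd
      rw [show c' = t * (2 * n - 1 - c / t) + (t - 1 - c % t) by omega, hBdef, mem_coreSet hm']
      change _ < N _
      have := h _ hm
      omega
    -- Take z = 1 if tn-1 is a gap, that is, if 1 is a leg; then the reflected position tn is filled
    -- and 0 is not a leg. Otherwise z = 0 works.
    by_cases h1 : 1 < t * n + 1 ∧ t * n + 1 - 1 - 1 ∉ B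
    · refine ⟨1, by omega, fun g ⟨hg, hgB⟩ => ?_⟩
      by_cases hg0 : g = 0
      · subst hg0
        exact absurd (key _ _ h1.2 (by omega)) hgB
      · by_cases hg1 : g = 1
        · exact Or.inl hg1
        · exact Or.inr ⟨g - 2, key _ _ hgB (by omega), by omega⟩
    · refine ⟨0, by omega, fun g ⟨hg, hgB⟩ => ?_⟩
      by_cases hg0 : g = 0
      · exact Or.inl hg0
      · by_cases hg1 : g = 1
        · subst hg1
          exact absurd ⟨hg, hgB⟩ h1
        · exact Or.inr ⟨g - 2, key _ _ hgB (by omega), by omega⟩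

end Core

end OddOrthFactor
namespace OddOrthFactor

/-! ### The sorting sign of the empty partition -/

section EmptySign

variable {K ρ : Type*} [Field K]

/-- The list `x m, …, x 1`. -/
def descending {α : Type*} (x : ℕ → α) : ℕ → List α
  | 0 => []
  | m + 1 => x (m + 1) :: descending x m

theorem length_descending {α : Type*} (x : ℕ → α) (m : ℕ) : (descending x m).length = m := by
  induction m with
  | zero => rfl
  | succ m ih => rw [descending, List.length_cons, ih]

theorem length_flatMap_const {α : Type*} (C : ℕ → List α) (p m : ℕ)
    (hC : ∀ i, 1 ≤ i → (C i).length = p) :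
    ((List.range' 1 m).flatMap C).length = m * p := by
  induction m with
  | zero => simp
  | succ m ih =>
    rw [List.range'_concat, List.flatMap_append, List.length_append, ih, List.flatMap_singleton,
      hC _ (by omega)]
    ring

/-- The entry x_{m+1} passes the m smaller x's and m classes of p entries each, which is (p+1)m
transpositions. -/
theorem ldet_interleave {κ : Type*} (f : ρ → κ → K) (R : List ρ) (C : ℕ → List κ) (x : ℕ → κ)
    (p : ℕ) (hC : ∀ i, 1 ≤ i → (C i).length = p) (m : ℕ) : ∀ A B : List κ,
    ldet f R (A ++ (descending x m ++ ((List.range' 1 m).flatMap C ++ B))) =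
      (-1) ^ ((p + 1) * m.choose 2) *
        ldet f R (A ++ ((List.range' 1 m).flatMap (fun i => x i :: C i) ++ B)) := by
  induction m with
  | zero =>
    intro A B
    simp [descending]
  | succ m ih =>
    intro A B
    have h1 := ldet_move_one f R A (descending x m ++ (List.range' 1 m).flatMap C)
      (C (m + 1) ++ B) (x (m + 1))
    rw [List.length_append, length_descending, length_flatMap_const C p m hC] at h1
    have h2 := ih A (x (m + 1) :: (C (m + 1) ++ B))
    rw [descending, List.range'_concat, List.flatMap_append, List.flatMap_append,
      List.flatMap_singleton, List.flatMap_singleton, one_mul, add_comm 1 m]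
    simp only [List.append_assoc, List.cons_append] at h1 h2 ⊢
    rw [h1, h2, ← mul_assoc, ← pow_add, Nat.choose_succ_succ' m 1, Nat.choose_one_right]
    congr 2
    ring

theorem partClass_bot_succ (t i p : ℕ) :
    partClass ⊥ t i (p + 1) = (t * p + i) :: partClass ⊥ t i p := by
  rw [partClass, List.ofFn_succ, partClass]
  simp only [rowLen_bot, zero_add, Fin.val_zero, Fin.val_succ]
  congr 2
  funext j
  rw [show p + 1 - 1 - ((j : ℕ) + 1) = p - 1 - j by omega]

theorem ofFn_beta_bot_succ (m : ℕ) :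
    List.ofFn (beta ⊥ (m + 1)) = m :: List.ofFn (beta ⊥ m) := by
  rw [List.ofFn_succ]
  simp only [beta, rowLen_bot, zero_add, Fin.val_zero, Fin.val_succ]
  congr 2
  funext j
  simp only [beta, rowLen_bot, zero_add]
  omega

theorem ofFn_beta_bot_add (c m : ℕ) :
    List.ofFn (beta ⊥ (c + 1 + m)) =
      descending (fun i => c + i) m ++ List.ofFn (beta ⊥ (c + 1)) := by
  induction m with
  | zero => rfl
  | succ m ih =>
    rw [← add_assoc, ofFn_beta_bot_succ, ih, descending, List.cons_append]
    congr 1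
    omega

/-- The residue classes of the beta-numbers of the empty partition. -/
def emptyClass (t n i : ℕ) : List ℕ := partClass ⊥ t i (n + if i = 0 then 1 else 0)

theorem inner_emptyClass (t n : ℕ) :
    inner (emptyClass (t + 1) n) (t + 1) 0 =
      partClass ⊥ (t + 1) 0 (n + 1) ++ (List.range' 1 t).flatMap fun i => partClass ⊥ (t + 1) i n := by
  rw [inner, mul_zero, Nat.sub_zero, List.range'_succ, List.flatMap_cons]
  congr 1
  simp only [List.flatMap_def]
  congr 1
  apply List.map_congr_left
  intro i hi
  rw [List.mem_range'_1] at hi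
  rw [emptyClass, if_neg (by omega), add_zero]

/-- The modulus is t+1 here. Raising n by one puts t+1 new numbers on top, and each has to be
carried to the head of its class. -/
theorem ldet_beta_bot (f : ρ → ℕ → K) (R : List ρ) (t n : ℕ) : ∀ A : List ℕ,
    ldet f R (A ++ List.ofFn (beta ⊥ ((t + 1) * n + 1))) =
      (-1) ^ ((n + 1).choose 2 * (t + 1).choose 2) *
        ldet f R (A ++ inner (emptyClass (t + 1) n) (t + 1) 0) := by
  induction n with
  | zero =>
    intro A
    have : ((List.range' 1 t).flatMap fun i => partClass ⊥ (t + 1) i 0) = [] := by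
      simp [partClass]
    rw [inner_emptyClass, this]
    simp [partClass, beta, rowLen_bot]
  | succ n ih =>
    intro A
    set c := (t + 1) * n with hc
    have e1 : List.ofFn (beta ⊥ ((t + 1) * (n + 1) + 1)) =
        ((t + 1) * (n + 1)) :: (descending (fun i => c + i) t ++ List.ofFn (beta ⊥ (c + 1))) := by
      rw [ofFn_beta_bot_succ, ← ofFn_beta_bot_add]
      congr 2
      · rw [hc]; ring
      · rw [hc]
        congr 1; ring
    rw [e1]
    have h1 := ih (A ++ ((t + 1) * (n + 1)) :: descending (fun i => c + i) t)
    rw [inner_emptyClass] at h1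
    have h2 := ldet_move f R (A ++ [(t + 1) * (n + 1)]) (descending (fun i => c + i) t)
      (partClass ⊥ (t + 1) 0 (n + 1)) ((List.range' 1 t).flatMap fun i => partClass ⊥ (t + 1) i n)
    have h3 := ldet_interleave f R (fun i => partClass ⊥ (t + 1) i n) (fun i => c + i) n
      (fun i _ => length_partClass _ _ _ _) t
      (A ++ ((t + 1) * (n + 1)) :: partClass ⊥ (t + 1) 0 (n + 1)) []
    rw [length_descending, length_partClass] at h2
    simp only [List.append_assoc, List.cons_append, List.append_nil, List.nil_append] at h1 h2 h3 ⊢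
    rw [h1, h2, h3, inner_emptyClass, partClass_bot_succ _ _ (n + 1), add_zero, List.cons_append,
      ← mul_assoc, ← mul_assoc, ← pow_add, ← pow_add]
    congr 2
    -- The t new nonzero residues pass the n+1 old members of class 0 and are then interleaved:
    -- t(n+1) + (n+1)C(t,2) = (n+1)C(t+1,2).
    · rw [Nat.choose_succ_succ' (n + 1) 1, Nat.choose_succ_succ' t 1, Nat.choose_one_right,
        Nat.choose_one_right]
      ring
    · simp only [partClass_bot_succ, hc]

end EmptySign

/-! ### Product formulas for the denominators -/

section Denominators

open Polynomial

variable {K : Type*} [Field K]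

theorem schurDen_eq_prod {N : ℕ} (x : Fin N → K) :
    schurDen x = ∏ i, ∏ j, if i < j then x i - x j else 1 := by
  have := Matrix.det_projVandermonde (fun _ : Fin N => (1 : K)) x
  simp only [one_mul] at this
  rw [schurDen]
  convert this using 1
  · congr 1
    ext i j
    simp [Matrix.projVandermonde_apply, Fin.val_rev, Nat.sub_sub, add_comm]
  · refine Finset.prod_congr rfl fun i _ => ?_
    rw [← Finset.prod_filter]
    refine Finset.prod_congr ?_ fun j _ => by ring
    ext j
    simp

theorem schurDen_snoc {N : ℕ} (x : Fin N → K) (z : K) :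
    schurDen (Fin.snoc (α := fun _ => K) x z : Fin (N + 1) → K) =
      schurDen x * ∏ r, (x r - z) := by
  rw [schurDen_eq_prod, schurDen_eq_prod, Fin.prod_univ_castSucc]
  have : ∀ k : Fin (N + 1), ¬ Fin.last N < k := fun k => not_lt.2 (Fin.le_last k)
  simp [Fin.prod_univ_castSucc, Finset.prod_mul_distrib, Fin.castSucc_lt_last, this]

theorem schurDen_ne_zero {N : ℕ} {x : Fin N → K} (hx : Function.Injective x) : schurDen x ≠ 0 := by
  rw [schurDen_eq_prod, Finset.prod_ne_zero_iff]
  intro i _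
  rw [Finset.prod_ne_zero_iff]
  intro j _
  split_ifs with h
  · exact sub_ne_zero.2 fun e => h.ne (hx e)
  · exact one_ne_zero

/-- The polynomials `P` with `(z - 1) * P_k (z + z⁻¹) = z ^ (k + 1) - z⁻¹ ^ k`. -/
noncomputable def oddPoly (K : Type*) [Field K] : ℕ → K[X]
  | 0 => 1
  | 1 => X + C 1
  | k + 2 => X * oddPoly K (k + 1) - oddPoly K k

theorem monic_oddPoly (k : ℕ) : (oddPoly K k).Monic ∧ (oddPoly K k).natDegree = k ∧
    (oddPoly K (k + 1)).Monic ∧ (oddPoly K (k + 1)).natDegree = k + 1 := by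
  induction k with
  | zero => exact ⟨monic_one, natDegree_one, monic_X_add_C 1, natDegree_X_add_C 1⟩
  | succ k ih =>
    obtain ⟨h1, h2, h3, h4⟩ := ih
    have hm : (X * oddPoly K (k + 1)).Monic := monic_X.mul h3
    have hd : (X * oddPoly K (k + 1)).natDegree = k + 2 := by
      rw [monic_X.natDegree_mul h3, natDegree_X, h4]
      ring
    have hlt : (oddPoly K k).natDegree < (X * oddPoly K (k + 1)).natDegree := by
      rw [hd, h2]; omega
    refine ⟨h3, h4, ?_, ?_⟩
    · exact hm.sub_of_left (degree_lt_degree hlt)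
    · rw [oddPoly, natDegree_sub_eq_left_of_natDegree_lt hlt, hd]

theorem eval_oddPoly {z : K} (hz : z ≠ 0) (k : ℕ) :
    (z - 1) * (oddPoly K k).eval (z + z⁻¹) = z ^ (k + 1) - z⁻¹ ^ k ∧
    (z - 1) * (oddPoly K (k + 1)).eval (z + z⁻¹) = z ^ (k + 2) - z⁻¹ ^ (k + 1) := by
  induction k with
  | zero =>
    constructor
    · simp [oddPoly]
    · simp only [oddPoly, eval_add, eval_X, eval_C]
      linear_combination mul_inv_cancel₀ hz
  | succ k ih =>
    refine ⟨ih.2, ?_⟩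
    rw [oddPoly, eval_sub, eval_mul, eval_X, mul_sub, ih.1, mul_left_comm, ih.2, add_mul]
    have h1 : z * z⁻¹ = 1 := mul_inv_cancel₀ hz
    have e1 : z * z⁻¹ ^ (k + 1) = z⁻¹ ^ k := by rw [pow_succ', ← mul_assoc, h1, one_mul]
    have e2 : z⁻¹ * z ^ (k + 2) = z ^ (k + 1) := by
      rw [pow_succ' z (k + 1), ← mul_assoc, mul_comm z⁻¹, h1, one_mul]
    rw [mul_sub, mul_sub, e1, e2]
    ring

/-- Row i is (x_i - 1) times monic polynomials in x_i + 1/x_i with one of each degree, so a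
Vandermonde determinant remains. -/
theorem ooDen_eq {N : ℕ} {x : Fin N → K} (hx : ∀ i, x i ≠ 0) :
    ooDen x = (∏ i, (x i - 1)) * schurDen fun i => x i + (x i)⁻¹ := by
  have h := Matrix.det_eval_matrixOfPolynomials_eq_det_vandermonde (fun i => x i + (x i)⁻¹)
    (fun j : Fin N => oddPoly K j) (fun j => (monic_oddPoly (j : ℕ)).2.1)
    (fun j => (monic_oddPoly (j : ℕ)).1)
  have h1 := congrArg (fun d => ((Equiv.Perm.sign (Fin.revPerm : Equiv.Perm (Fin N)) : ℤ) : K) * d) h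
  simp only [← Matrix.det_permute'] at h1
  have e1 : schurDen (fun i => x i + (x i)⁻¹) = ((Matrix.vandermonde fun i => x i + (x i)⁻¹).submatrix
      id (Fin.revPerm : Equiv.Perm (Fin N))).det := by
    rw [schurDen]
    congr 1
    ext i j
    simp [Matrix.vandermonde_apply, Fin.val_rev, Nat.sub_sub, add_comm]
  rw [e1, h1, ← Matrix.det_mul_column, ooDen]
  congr 1
  ext i j
  simp only [Matrix.of_apply, Matrix.submatrix_apply, id, Fin.revPerm_apply, Fin.val_rev]
  rw [(eval_oddPoly (hx i) _).1, show N - ((j : ℕ) + 1) = N - 1 - j by omega]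

theorem ooDen_snoc {N : ℕ} {x : Fin N → K} {z : K} (hx : ∀ i, x i ≠ 0) (hz : z ≠ 0) :
    ooDen (Fin.snoc (α := fun _ => K) x z : Fin (N + 1) → K) =
      ooDen x * (z - 1) * ∏ r, (x r + (x r)⁻¹ - (z + z⁻¹)) := by
  have e : (fun i => (Fin.snoc (α := fun _ => K) x z : Fin (N + 1) → K) i +
      ((Fin.snoc (α := fun _ => K) x z : Fin (N + 1) → K) i)⁻¹) =
      Fin.snoc (α := fun _ => K) (fun i => x i + (x i)⁻¹) (z + z⁻¹) := by
    funext i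
    refine Fin.lastCases ?_ (fun i => ?_) i <;> simp
  rw [ooDen_eq, ooDen_eq hx, e, schurDen_snoc, Fin.prod_univ_castSucc]
  · simp only [Fin.snoc_castSucc, Fin.snoc_last]
    ring
  · intro i
    refine Fin.lastCases ?_ (fun i => ?_) i
    · simpa using hz
    · simpa using hx i

theorem prod_doubled_sub {n : ℕ} (t : ℕ) (x : Fin n → K) (z : K) :
    ∏ r, (doubled t x r - z) = ∏ b, ((x b ^ t - z) * ((x b)⁻¹ ^ t - z)) := by
  rw [Fin.prod_univ_add, Finset.prod_mul_distrib]
  simp only [doubled, Fin.append_left, Fin.append_right]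

/-- For each x, with Z = y^t: (x^t - Z)(x^(-t) - Z) = Z² (x^t - 1/Z)(x^(-t) - 1/Z). -/
theorem schurDen_snoc_inv {n : ℕ} (t : ℕ) {x : Fin n → K} {y : K} (hx : ∀ b, x b ≠ 0)
    (hy : y ≠ 0) :
    schurDen (Fin.snoc (α := fun _ => K) (doubled t x) (y⁻¹ ^ t) : Fin (n + n + 1) → K) *
        y ^ (2 * (t * n)) =
      schurDen (Fin.snoc (α := fun _ => K) (doubled t x) (y ^ t) : Fin (n + n + 1) → K) := by
  rw [schurDen_snoc, schurDen_snoc, mul_assoc]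
  congr 1
  rw [prod_doubled_sub, prod_doubled_sub,
    show y ^ (2 * (t * n)) = ∏ _b : Fin n, (y ^ t) ^ 2 by
      rw [Finset.prod_const, Finset.card_univ, Fintype.card_fin, ← pow_mul, ← pow_mul]
      congr 1
      ring,
    ← Finset.prod_mul_distrib]
  refine Finset.prod_congr rfl fun b _ => ?_
  have h1 : y ^ t ≠ 0 := pow_ne_zero _ hy
  have h2 : x b ^ t ≠ 0 := pow_ne_zero _ (hx b)
  rw [inv_pow, inv_pow]
  field_simp
  ring

/-- Adding one variable to either denominator multiplies it by comparable factors, since with X =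
x^t and Z = y^t one has (X + 1/X - Z - 1/Z) Z = -(X - Z)(1/X - Z). -/
theorem ooDen_snoc_mul {n : ℕ} (t : ℕ) {x : Fin n → K} {y : K} (hx : ∀ b, x b ≠ 0)
    (hy : y ≠ 0) :
    ooDen (Fin.snoc (α := fun _ => K) (fun b => x b ^ t) (y ^ t) : Fin (n + 1) → K) *
        schurDen (doubled t x) * y ^ (t * n) =
      (-1) ^ n * (y ^ t - 1) * ooDen (fun b => x b ^ t) *
        schurDen (Fin.snoc (α := fun _ => K) (doubled t x) (y ^ t) : Fin (n + n + 1) → K) := by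
  rw [schurDen_snoc, ooDen_snoc (fun b => pow_ne_zero _ (hx b)) (pow_ne_zero _ hy)]
  have : (∏ b, (x b ^ t + (x b ^ t)⁻¹ - (y ^ t + (y ^ t)⁻¹))) * y ^ (t * n) =
      (-1) ^ n * ∏ r, (doubled t x r - y ^ t) := by
    rw [prod_doubled_sub,
      show y ^ (t * n) = ∏ _b : Fin n, y ^ t by
        rw [Finset.prod_const, Finset.card_univ, Fintype.card_fin, ← pow_mul],
      show ((-1 : K)) ^ n = ∏ _b : Fin n, (-1) by
        rw [Finset.prod_const, Finset.card_univ, Fintype.card_fin],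
      ← Finset.prod_mul_distrib, ← Finset.prod_mul_distrib]
    refine Finset.prod_congr rfl fun b _ => ?_
    have h1 : y ^ t ≠ 0 := pow_ne_zero _ hy
    have h2 : x b ^ t ≠ 0 := pow_ne_zero _ (hx b)
    rw [inv_pow]
    field_simp
    ring
  linear_combination ooDen (fun b => x b ^ t) * (y ^ t - 1) * schurDen (doubled t x) * this

theorem ooDen_ne_zero {n : ℕ} {t : ℕ} {x : Fin n → K} (hx : ∀ b, x b ≠ 0)
    (hinj : Function.Injective (doubled t x)) : ooDen (fun b => x b ^ t) ≠ 0 := by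
  have hX : ∀ b, x b ^ t ≠ 0 := fun b => pow_ne_zero _ (hx b)
  have h1 : ∀ a b, x a ^ t ≠ (x b)⁻¹ ^ t := by
    intro a b h
    have : doubled t x (Fin.castAdd n a) = doubled t x (Fin.natAdd n b) := by
      rw [doubled, Fin.append_left, Fin.append_right, h]
    have := congrArg Fin.val (hinj this)
    simp only [Fin.val_castAdd, Fin.val_natAdd] at this
    omega
  have h2 : ∀ a b, x a ^ t = x b ^ t → a = b := by
    intro a b h
    have : doubled t x (Fin.castAdd n a) = doubled t x (Fin.castAdd n b) := by
      rw [doubled, Fin.append_left, Fin.append_left, h]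
    exact Fin.castAdd_injective _ _ (hinj this)
  rw [ooDen_eq hX]
  refine mul_ne_zero (Finset.prod_ne_zero_iff.2 fun b _ => ?_) (schurDen_ne_zero fun a b hab => ?_)
  · rw [sub_ne_zero]
    intro h
    exact h1 b b (by rw [inv_pow, h, inv_one])
  · by_contra hne
    -- With A = x_a^t and B = x_b^t, equality of A + 1/A and B + 1/B forces A = B or AB = 1, and
    -- injectivity excludes AB = 1.
    have e : (x a ^ t - x b ^ t) * (x b ^ t - (x a)⁻¹ ^ t) = 0 := by
      have h3 := hX a
      have h4 := hX b
      rw [inv_pow]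
      field_simp at hab ⊢
      linear_combination hab
    rcases mul_eq_zero.1 e with e | e
    · exact hne (h2 _ _ (sub_eq_zero.1 e))
    · exact h1 _ _ (sub_eq_zero.1 e)

end Denominators

/-! ### Nonvanishing for indeterminates -/

section Indeterminates

theorem xvar_ne_zero {n : ℕ} (i : Fin n) : xvar i ≠ 0 := by
  rw [xvar, Ne, FaithfulSMul.algebraMap_eq_zero_iff]
  exact MvPolynomial.X_ne_zero _

theorem yvar_ne_zero (n : ℕ) : yvar n ≠ 0 := by
  rw [yvar, Ne, FaithfulSMul.algebraMap_eq_zero_iff]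
  exact MvPolynomial.X_ne_zero _

theorem two_pow_ne_one {t : ℕ} (ht : t ≠ 0) : (2 : ℂ) ^ t ≠ 1 := by
  intro h
  have : (2 : ℕ) ^ t = 1 := by exact_mod_cast h
  have := Nat.one_lt_two_pow ht
  omega

/-- Two polynomials are separated by evaluating the i-th variable at 2 and all others at 1; in
`gen_pow_mul_ne` every variable is evaluated at 2. -/
theorem gen_pow_ne {n t : ℕ} (ht : t ≠ 0) {i j : Option (Fin n)} (hij : i ≠ j) :
    (algebraMap (MvPolynomial (Option (Fin n)) ℂ) (RatFunField n) (MvPolynomial.X i)) ^ t ≠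
      (algebraMap (MvPolynomial (Option (Fin n)) ℂ) (RatFunField n) (MvPolynomial.X j)) ^ t := by
  classical
  rw [← map_pow, ← map_pow]
  intro h
  have h1 := FaithfulSMul.algebraMap_injective _ _ h
  have h2 := congrArg (MvPolynomial.eval fun k => if k = i then (2 : ℂ) else 1) h1
  simp [hij.symm] at h2
  exact two_pow_ne_one ht h2

theorem gen_pow_mul_ne {n t : ℕ} (ht : t ≠ 0) (i j : Option (Fin n)) :
    (algebraMap (MvPolynomial (Option (Fin n)) ℂ) (RatFunField n) (MvPolynomial.X i)) ^ t ≠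
      (algebraMap (MvPolynomial (Option (Fin n)) ℂ) (RatFunField n) (MvPolynomial.X j))⁻¹ ^ t := by
  intro h
  have hj : algebraMap (MvPolynomial (Option (Fin n)) ℂ) (RatFunField n) (MvPolynomial.X j) ≠ 0 := by
    rw [Ne, FaithfulSMul.algebraMap_eq_zero_iff]
    exact MvPolynomial.X_ne_zero _
  rw [inv_pow, ← mul_eq_one_iff_eq_inv₀ (pow_ne_zero _ hj), ← mul_pow, ← map_mul, ← map_pow,
    ← map_one (algebraMap (MvPolynomial (Option (Fin n)) ℂ) (RatFunField n))] at h
  have h1 := FaithfulSMul.algebraMap_injective _ _ h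
  have h2 := congrArg (MvPolynomial.eval fun _ => (2 : ℂ)) h1
  simp only [map_pow, map_mul, MvPolynomial.eval_X, map_one] at h2
  rw [mul_pow, ← pow_add] at h2
  exact two_pow_ne_one (by omega) h2

theorem yvar_pow_ne_one {n t : ℕ} (ht : t ≠ 0) : yvar n ^ t ≠ 1 := by
  intro h
  exact gen_pow_mul_ne (n := n) ht none none (by
    change yvar n ^ t = (yvar n)⁻¹ ^ t
    rw [inv_pow, h, inv_one])

theorem injective_doubled_snoc {n t : ℕ} (ht : t ≠ 0) :
    Function.Injective (Fin.snoc (α := fun _ => RatFunField n)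
      (doubled t (xvar : Fin n → RatFunField n)) (yvar n ^ t) :
      Fin (n + n + 1) → RatFunField n) := by
  have hxx : ∀ a b : Fin n, xvar a ^ t = xvar b ^ t → a = b := by
    intro a b h
    by_contra hne
    exact gen_pow_ne ht (i := some a) (j := some b) (by simpa using hne) h
  have hxi : ∀ a b : Fin n, xvar a ^ t ≠ (xvar b)⁻¹ ^ t :=
    fun a b => gen_pow_mul_ne ht (some a) (some b)
  have hxy : ∀ a : Fin n, xvar a ^ t ≠ yvar n ^ t :=
    fun a => gen_pow_ne ht (i := some a) (j := none) (by simp)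
  have hiy : ∀ a : Fin n, (xvar a)⁻¹ ^ t ≠ yvar n ^ t :=
    fun a => (gen_pow_mul_ne ht none (some a)).symm
  have hii : ∀ a b : Fin n, (xvar a)⁻¹ ^ t = (xvar b)⁻¹ ^ t → a = b := by
    intro a b h
    rw [inv_pow, inv_pow, inv_inj] at h
    exact hxx a b h
  have hd : Function.Injective (doubled t (xvar : Fin n → RatFunField n)) := by
    intro r s
    refine Fin.addCases (fun a => ?_) (fun a => ?_) r <;>
      refine Fin.addCases (fun b => ?_) (fun b => ?_) s <;>
      simp only [doubled, Fin.append_left, Fin.append_right]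
    · intro h
      rw [hxx a b h]
    · exact fun h => (hxi a b h).elim
    · exact fun h => (hxi b a h.symm).elim
    · intro h
      rw [hii a b h]
  rw [Fin.snoc_injective_iff]
  refine ⟨hd, ?_⟩
  rintro ⟨r, hr⟩
  revert hr
  refine Fin.addCases (fun a => ?_) (fun a => ?_) r <;>
    simp only [doubled, Fin.append_left, Fin.append_right]
  · exact hxy a
  · exact hiy a

end Indeterminates

end OddOrthFactor
namespace OddOrthFactor

/-! ### Bookkeeping of signs -/

section Signs

theorem prod_range_eq_mul {M : Type*} [CommMonoid M] (g : ℕ → M) {i₀ m : ℕ} (h : i₀ < m) :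
    ∏ i ∈ Finset.range m, g i =
      (∏ i ∈ Finset.range i₀, g i) * g i₀ * ∏ i ∈ Finset.Ico (i₀ + 1) m, g i := by
  rw [← Finset.prod_range_succ, Finset.prod_range_mul_prod_Ico g (by omega)]

theorem prod_range_erase_eq_mul {M : Type*} [CommMonoid M] (g : ℕ → M) {i₀ m : ℕ} (h : i₀ < m) :
    ∏ i ∈ (Finset.range m).erase i₀, g i =
      (∏ i ∈ Finset.range i₀, g i) * ∏ i ∈ Finset.Ico (i₀ + 1) m, g i := by
  rw [← Finset.prod_union]
  · refine Finset.prod_congr ?_ fun _ _ => rfl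
    ext i
    simp only [Finset.mem_erase, Finset.mem_range, Finset.mem_union, Finset.mem_Ico]
    omega
  · rw [Finset.disjoint_left]
    intro i
    simp only [Finset.mem_range, Finset.mem_Ico]
    omega

variable (K : Type*) [Field K]

/-- The sign contributed by the pair of residues `i`, `t - 1 - i`. -/
def resSign (lam : YoungDiagram) (t n i : ℕ) : K :=
  (-1) ^ (t * n * (resCount lam t (t * n + 1) (t - 1 - i) + n)) *
    (-1) ^ ((resCount lam t (t * n + 1) (t - 1 - i) + 1).choose 2)

variable {K}

theorem prod_neg_one_zpow (s : Finset ℕ) (g : ℕ → ℤ) :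
    ((-1 : K)) ^ (∑ i ∈ s, g i) = ∏ i ∈ s, (-1 : K) ^ g i := by
  classical
  induction s using Finset.induction_on with
  | empty => simp
  | insert a s ha ih =>
    rw [Finset.sum_insert ha, Finset.prod_insert ha, zpow_add₀ (by simp), ih]

theorem prod_Icc_eq_prod_range {M : Type*} [CommMonoid M] (g : ℕ → M) {t m : ℕ} (h : m < t) :
    ∏ i ∈ Finset.Icc (t - m) (t - 1), g i = ∏ i ∈ Finset.range m, g (t - 1 - i) := by
  symm
  refine Finset.prod_bij' (fun i _ => t - 1 - i) (fun i _ => t - 1 - i) ?_ ?_ ?_ ?_ ?_ <;>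
    simp only [Finset.mem_range, Finset.mem_Icc] <;> intro a ha <;> first | omega | trivial

/-- The reindexing i ↦ t-1-i turns the sums of ε₁ over upper residues into products over pairs. -/
theorem neg_one_zpow_eps (lam : YoungDiagram) {t n i₀ : ℕ} (hi₀ : i₀ < t) :
    (-1 : K) ^ eps lam t n i₀ =
      (∏ i ∈ Finset.range i₀, (-1) ^ resCount lam t (t * n + 1) (t - 1 - i)) *
        ∏ i ∈ Finset.range (t / 2), resSign K lam t n i := by
  rw [eps, zpow_add₀ (by simp), prod_neg_one_zpow, prod_neg_one_zpow,
    show (t + 1) / 2 = t - t / 2 by omega, prod_Icc_eq_prod_range _ hi₀,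
    prod_Icc_eq_prod_range _ (by omega)]
  congr 1
  · simp only [zpow_natCast]
  refine Finset.prod_congr rfl fun i _ => ?_
  rw [zpow_add₀ (by simp), resSign, mul_comm, zpow_natCast]
  congr 1
  generalize resCount lam t (t * n + 1) (t - 1 - i) = q
  -- Peeling produces q+n where ε₁ has q-n; the difference 2tn² is even.
  have : (t : ℤ) * n * ((q : ℤ) - n) = (t * n * (q + n) : ℕ) - 2 * (t * n * n : ℕ) := by
    push_cast
    ring
  rw [this, zpow_sub₀ (by simp), zpow_natCast, zpow_mul]
  simp

/-- Here n_{t-1-i} = n for every pair, and C(t,2) + ⌊t/2⌋ is even: it equals 2k² for t = 2k and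
2k(k+1) for t = 2k+1. -/
theorem prod_resSign_bot {t n : ℕ} (ht : 2 ≤ t) :
    (-1) ^ ((n + 1).choose 2 * t.choose 2) * ∏ i ∈ Finset.range (t / 2), resSign K ⊥ t n i = 1 := by
  have h1 : ∀ i ∈ Finset.range (t / 2), resSign K ⊥ t n i = (-1) ^ ((n + 1).choose 2) := by
    intro i hi
    rw [Finset.mem_range] at hi
    rw [resSign, resCount_bot (by omega), if_neg (by omega), add_zero,
      (show Even (t * n * (n + n)) from ⟨t * n * n, by ring⟩).neg_one_pow, one_mul]
  rw [Finset.prod_congr rfl h1, Finset.prod_const, Finset.card_range, ← pow_mul, ← pow_add,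
    ← mul_add]
  apply Even.neg_one_pow
  apply Even.mul_left
  obtain ⟨k, rfl | rfl⟩ := Nat.even_or_odd' t
  · rw [Nat.choose_two_right, show 2 * k * (2 * k - 1) / 2 = k * (2 * k - 1) by
      rw [mul_assoc, Nat.mul_div_cancel_left _ (by omega)], show 2 * k / 2 = k by omega]
    obtain ⟨m, rfl⟩ := Nat.exists_eq_add_of_le (show 1 ≤ k by omega)
    rw [show 2 * (1 + m) - 1 = 2 * m + 1 by omega]
    exact ⟨(1 + m) * (m + 1), by ring⟩
  · rw [Nat.choose_two_right, show (2 * k + 1) * (2 * k + 1 - 1) / 2 = (2 * k + 1) * k by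
      rw [Nat.add_sub_cancel, mul_left_comm, Nat.mul_div_cancel_left _ (by omega)],
      show (2 * k + 1) / 2 = k by omega]
    exact ⟨(k + 1) * k, by ring⟩

end Signs

/-! ### Evaluating the sorted determinants and forming the quotient -/

section Assembly

variable {t n : ℕ}

theorem IsMiddle.pair {lam : YoungDiagram} {i₀ : ℕ} (h : IsMiddle lam t n i₀) {i : ℕ}
    (hi : 2 * i + 1 < t) :
    resCount lam t (t * n + 1) i + resCount lam t (t * n + 1) (t - 1 - i) =
      2 * n + if i = i₀ then 1 else 0 := by
  rw [h.2 i (by omega)]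
  split_ifs <;> omega

theorem IsMiddle.mid {lam : YoungDiagram} {i₀ : ℕ} (h : IsMiddle lam t n i₀) {i : ℕ}
    (hi : 2 * i + 1 = t) :
    resCount lam t (t * n + 1) i = n + if i = i₀ then 1 else 0 := by
  have := h.2 i (by omega)
  rw [show t - 1 - i = i by omega] at this
  split_ifs at this ⊢ <;> omega

/-- As t ≥ 2, residue 0 is not self-paired, so the empty partition always falls under the case i₀ ≠
(t-1)/2. -/
theorem isMiddle_bot (ht : 2 ≤ t) : IsMiddle ⊥ t n 0 := by
  refine ⟨Nat.zero_le _, fun i hi => ?_⟩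
  rw [resCount_bot (by omega), resCount_bot (by omega)]
  split_ifs <;> omega

/-- The determinant of the separated kernel with sorted columns. -/
noncomputable def sortedDet (lam : YoungDiagram) (t n : ℕ) : RatFunField n :=
  ldet (sepKernel t xvar (yvar n)) (inner (sepRows n) t 0 ++ [none])
    (inner (resClass (beta lam (t * n + 1)) t) t 0)

/-- The sign and product of variables common to all pair blocks. -/
noncomputable def pairConst (n : ℕ) : RatFunField n := (-1) ^ n * ∏ b : Fin n, xvar b

/-- The common factor of the middle block. -/
noncomputable def midConst (t n : ℕ) : RatFunField n :=
  if Odd t then (∏ b : Fin n, (xvar b)⁻¹ ^ (t / 2)) * ooDen (Xt t n) else 1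

/-- The common factor of all sorted determinants. -/
noncomputable def totalConst (t n : ℕ) : RatFunField n :=
  (-1) ^ (t * n) * pairConst n * (pairConst n * schurDen (XXt t n)) ^ (t / 2 - 1) *
    schurDen (adjoinVar (XXt t n) (yvar n ^ t)) * (yvar n ^ (t * n))⁻¹ * midConst t n

theorem schurDen_XXt_yvar_ne_zero (ht : t ≠ 0) :
    schurDen (adjoinVar (XXt t n) (yvar n ^ t)) ≠ 0 :=
  schurDen_ne_zero (injective_doubled_snoc ht)

theorem schurDen_XXt_ne_zero (ht : t ≠ 0) : schurDen (XXt t n) ≠ 0 :=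
  schurDen_ne_zero ((Fin.snoc_injective_iff.1 (injective_doubled_snoc ht)).1)

theorem schurDen_XXt_yvar_inv (t n : ℕ) :
    schurDen (adjoinVar (XXt t n) ((yvar n)⁻¹ ^ t)) * yvar n ^ (2 * (t * n)) =
      schurDen (adjoinVar (XXt t n) (yvar n ^ t)) :=
  schurDen_snoc_inv t xvar_ne_zero (yvar_ne_zero n)

theorem schurDen_XXt_yvar_inv_ne_zero (ht : t ≠ 0) :
    schurDen (adjoinVar (XXt t n) ((yvar n)⁻¹ ^ t)) ≠ 0 := by
  intro h
  have := schurDen_XXt_yvar_inv t n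
  rw [h, zero_mul] at this
  exact schurDen_XXt_yvar_ne_zero ht this.symm

theorem ooDen_Xt_ne_zero (ht : t ≠ 0) : ooDen (Xt t n) ≠ 0 :=
  ooDen_ne_zero xvar_ne_zero ((Fin.snoc_injective_iff.1 (injective_doubled_snoc ht)).1)

theorem ooDen_Xt_yvar_mul (t n : ℕ) :
    ooDen (adjoinVar (Xt t n) (yvar n ^ t)) * schurDen (XXt t n) * yvar n ^ (t * n) =
      (-1) ^ n * (yvar n ^ t - 1) * ooDen (Xt t n) *
        schurDen (adjoinVar (XXt t n) (yvar n ^ t)) :=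
  ooDen_snoc_mul t xvar_ne_zero (yvar_ne_zero n)

theorem ooDen_Xt_yvar_ne_zero (ht : t ≠ 0) : ooDen (adjoinVar (Xt t n) (yvar n ^ t)) ≠ 0 := by
  intro h
  have := ooDen_Xt_yvar_mul t n
  rw [h, zero_mul, zero_mul] at this
  refine mul_ne_zero (mul_ne_zero (mul_ne_zero (pow_ne_zero _ (by simp)) ?_) (ooDen_Xt_ne_zero ht))
    (schurDen_XXt_yvar_ne_zero ht) this.symm
  exact sub_ne_zero.2 (yvar_pow_ne_one ht)

theorem yvar_sub_one_ne_zero (n : ℕ) : yvar n - 1 ≠ 0 := by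
  rw [sub_ne_zero]
  simpa using yvar_pow_ne_one (n := n) one_ne_zero

theorem pairConst_ne_zero (n : ℕ) : pairConst n ≠ 0 :=
  mul_ne_zero (pow_ne_zero _ (by simp)) (Finset.prod_ne_zero_iff.2 fun b _ => xvar_ne_zero b)

theorem prod_inv_xvar_ne_zero (n m : ℕ) : ∏ b : Fin n, (xvar b)⁻¹ ^ m ≠ 0 :=
  Finset.prod_ne_zero_iff.2 fun b _ => pow_ne_zero _ (inv_ne_zero (xvar_ne_zero b))

theorem totalConst_ne_zero (ht : t ≠ 0) : totalConst t n ≠ 0 := by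
  have hm : midConst t n ≠ 0 := by
    rw [midConst]
    split_ifs
    · exact mul_ne_zero (prod_inv_xvar_ne_zero n _) (ooDen_Xt_ne_zero ht)
    · exact one_ne_zero
  exact mul_ne_zero (mul_ne_zero (mul_ne_zero (mul_ne_zero (mul_ne_zero
    (pow_ne_zero _ (by simp)) (pairConst_ne_zero n)) (pow_ne_zero _ (mul_ne_zero
      (pairConst_ne_zero n) (schurDen_XXt_ne_zero ht)))) (schurDen_XXt_yvar_ne_zero ht))
    (inv_ne_zero (pow_ne_zero _ (yvar_ne_zero n)))) hm

theorem pairFactor_eq (ht : t ≠ 0) {lam : YoungDiagram} {i : ℕ} (hi : 2 * i + 1 < t)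
    (h : resCount lam t (t * n + 1) i + resCount lam t (t * n + 1) (t - 1 - i) = 2 * n) :
    pairFactor (sepKernel t xvar (yvar n)) (sepRows n) (resClass (beta lam (t * n + 1)) t) t n i =
      resSign (RatFunField n) lam t n i * (pairConst n * schurDen (XXt t n)) *
        schur (piParts lam t n i (n + n)) (XXt t n) := by
  rw [pairFactor, length_resClass_beta, resClass_beta, resClass_beta,
    ldet_pairBlock (by omega) (fun j hj => rowLen_quo_of_le _ _ _ _ hj)
      (fun j hj => rowLen_quo_of_le _ _ _ _ hj) hi _ xvar_ne_zero, resSign, pairConst]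
  change _ * (_ * _ * schurNum (piParts lam t n i (n + n)) (XXt t n)) = _
  rw [schur_mul_schurDen _ (schurDen_XXt_ne_zero ht)]
  ring

/-- The bracket in the evaluation for `i₀ ≠ (t - 1) / 2`. -/
noncomputable def bracket (lam : YoungDiagram) (t n i₀ : ℕ) : RatFunField n :=
  yvar n ^ (-muExp lam t n i₀ + 1) *
      schur (piParts lam t n i₀ (n + n + 1)) (adjoinVar (XXt t n) (yvar n ^ t)) -
    yvar n ^ muExp lam t n i₀ *
      schur (piParts lam t n i₀ (n + n + 1)) (adjoinVar (XXt t n) ((yvar n)⁻¹ ^ t))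

theorem ldet_lastBlock_eq (ht : t ≠ 0) {lam : YoungDiagram} {i : ℕ} (hi : 2 * i + 1 < t)
    (h : resCount lam t (t * n + 1) i + resCount lam t (t * n + 1) (t - 1 - i) = 2 * n + 1) :
    (-1) ^ (t * n * (resCount lam t (t * n + 1) (t - 1 - i) + n)) *
      ldet (sepKernel t xvar (yvar n)) (sepRows n i ++ (sepRows n (t - 1 - i) ++ [none]))
        (resClass (beta lam (t * n + 1)) t i ++ resClass (beta lam (t * n + 1)) t (t - 1 - i)) =
      resSign (RatFunField n) lam t n i * pairConst n *
        (schurDen (adjoinVar (XXt t n) (yvar n ^ t)) * (yvar n ^ (t * n))⁻¹) *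
        bracket lam t n i := by
  rw [resClass_beta, resClass_beta,
    ldet_pairBlock_last (by omega) (fun j hj => rowLen_quo_of_le _ _ _ _ hj)
      (fun j hj => rowLen_quo_of_le _ _ _ _ hj) hi xvar_ne_zero (yvar_ne_zero n), resSign, pairConst]
  change _ * (_ * (_ * schurNum (piParts lam t n i (n + n + 1)) (adjoinVar (XXt t n) (yvar n ^ t)) -
    _ * schurNum (piParts lam t n i (n + n + 1)) (adjoinVar (XXt t n) ((yvar n)⁻¹ ^ t)))) = _
  rw [schur_mul_schurDen _ (schurDen_XXt_yvar_ne_zero ht),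
    schur_mul_schurDen _ (schurDen_XXt_yvar_inv_ne_zero ht), ← schurDen_XXt_yvar_inv t n, bracket]
  have hy := yvar_ne_zero n
  set M := (quo lam t (t * n + 1) (t - 1 - i)).rowLen 0 +
    resCount lam t (t * n + 1) (t - 1 - i) with hM
  have hmu : muExp lam t n i = (t * M : ℕ) - (t * n : ℕ) - (i : ℕ) := by
    rw [muExp, hM]
    push_cast
    ring
  -- The denominators with y^t and y^(-t) differ by y^(2tn). Giving half of this power to each term
  -- produces the exponents 1-μ and μ.
  have e1 : yvar n ^ (-muExp lam t n i + 1) =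
      yvar n ^ (t * n) * (yvar n ^ (i + 1) * ((yvar n)⁻¹ ^ t) ^ M) := by
    rw [← pow_mul, inv_pow, ← zpow_natCast, ← zpow_natCast, ← zpow_natCast, ← zpow_neg,
      ← zpow_add₀ hy, ← zpow_add₀ hy, hmu]
    congr 1
    push_cast
    ring
  have e2 : yvar n ^ muExp lam t n i * yvar n ^ (t * n) =
      (yvar n)⁻¹ ^ i * (yvar n ^ t) ^ M := by
    rw [← pow_mul, inv_pow, ← zpow_natCast, ← zpow_natCast, ← zpow_natCast, ← zpow_neg,
      ← zpow_add₀ hy, ← zpow_add₀ hy, hmu]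
    congr 1
    push_cast
    ring
  rw [← e2, e1]
  have hyp : yvar n ^ (t * n) ≠ 0 := pow_ne_zero _ hy
  rw [show 2 * (t * n) = t * n + t * n by ring, pow_add (yvar n) (t * n) (t * n)]
  field_simp

/-- Apart from the sign, the constant does not depend on λ or i₀: there are ⌊t/2⌋-1 pairs besides
i₀, wherever i₀ lies. -/
theorem sortedDet_of_ne (ht : t ≠ 0) {lam : YoungDiagram} {i₀ : ℕ} (h : IsMiddle lam t n i₀)
    (hi₀ : 2 * i₀ + 1 < t) :
    sortedDet lam t n = (-1) ^ eps lam t n i₀ * totalConst t n * (bracket lam t n i₀ *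
      (∏ i ∈ (Finset.range (t / 2)).erase i₀, schur (piParts lam t n i (n + n)) (XXt t n)) *
      if Odd t then oo (parts (quo lam t (t * n + 1) ((t - 1) / 2)) n) (Xt t n) else 1) := by
  have hmid : (if Odd t then ldet (sepKernel t xvar (yvar n)) (sepRows n (t / 2))
      (resClass (beta lam (t * n + 1)) t (t / 2)) else 1) = midConst t n *
      if Odd t then oo (parts (quo lam t (t * n + 1) ((t - 1) / 2)) n) (Xt t n) else 1 := by
    rw [midConst]
    split_ifs with hodd
    · obtain ⟨m, rfl⟩ := hodd
      have e1 : (2 * m + 1) / 2 = m := by omega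
      have e2 : (2 * m + 1 - 1) / 2 = m := by omega
      rw [e1, e2, resClass_beta, h.mid rfl, if_neg (by omega), add_zero,
        ldet_midBlock _ rfl _ xvar_ne_zero]
      change _ * ooNum _ (Xt (2 * m + 1) n) = _
      rw [oo_mul_ooDen _ (ooDen_Xt_ne_zero ht)]
      ring
    · rw [one_mul]
  have hlast := ldet_lastBlock_eq ht hi₀ (by rw [h.pair hi₀, if_pos rfl])
  have hA : ∀ i ∈ Finset.range i₀, pairFactor (sepKernel t xvar (yvar n)) (sepRows n)
      (resClass (beta lam (t * n + 1)) t) t n i = resSign (RatFunField n) lam t n i *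
        (pairConst n * schurDen (XXt t n)) * schur (piParts lam t n i (n + n)) (XXt t n) := by
    intro i hi
    rw [Finset.mem_range] at hi
    exact pairFactor_eq ht (by omega) (by rw [h.pair (by omega), if_neg (by omega), add_zero])
  have hB : ∀ i ∈ Finset.Ico (i₀ + 1) (t / 2), pairFactor (sepKernel t xvar (yvar n)) (sepRows n)
      (resClass (beta lam (t * n + 1)) t) t n i = resSign (RatFunField n) lam t n i *
        (pairConst n * schurDen (XXt t n)) * schur (piParts lam t n i (n + n)) (XXt t n) := by
    intro i hi
    rw [Finset.mem_Ico] at hi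
    exact pairFactor_eq ht (by omega) (by rw [h.pair (by omega), if_neg (by omega), add_zero])
  rw [sortedDet, ldet_inner_middle_ne _ _ _ t n (length_sepRows n)
    (sepKernel_eq_zero t xvar (yvar n) (beta lam (t * n + 1))) none i₀ hi₀
    (fun i hi => by rw [length_resClass_beta, length_resClass_beta, h.pair hi])
    (fun i hi => by rw [length_resClass_beta, h.mid hi]), hmid]
  simp only [length_resClass_beta]
  have hprod : ∀ s : Finset ℕ, ∏ i ∈ s, (resSign (RatFunField n) lam t n i *
      (pairConst n * schurDen (XXt t n)) * schur (piParts lam t n i (n + n)) (XXt t n)) =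
      (∏ i ∈ s, resSign (RatFunField n) lam t n i) * (pairConst n * schurDen (XXt t n)) ^ s.card *
        ∏ i ∈ s, schur (piParts lam t n i (n + n)) (XXt t n) := fun s => by
    rw [Finset.prod_mul_distrib, Finset.prod_mul_distrib, Finset.prod_const]
  rw [hlast, Finset.prod_mul_distrib, Finset.prod_congr rfl hA, Finset.prod_congr rfl hB,
    hprod, hprod, Finset.card_range, Nat.card_Ico,
    neg_one_zpow_eps lam (by omega), prod_range_erase_eq_mul _ (by omega),
    prod_range_eq_mul (fun i => resSign (RatFunField n) lam t n i) (show i₀ < t / 2 by omega),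
    totalConst, show t / 2 - 1 = i₀ + (t / 2 - (i₀ + 1)) by omega, pow_add]
  ring

theorem sortedDet_of_eq (ht : t ≠ 0) {lam : YoungDiagram} {i₀ : ℕ} (h : IsMiddle lam t n i₀)
    (hi₀ : 2 * i₀ + 1 = t) :
    sortedDet lam t n = (-1) ^ eps lam t n i₀ * (pairConst n * schurDen (XXt t n)) ^ i₀ *
      ((∏ b : Fin n, (xvar b)⁻¹ ^ i₀) * (yvar n)⁻¹ ^ i₀ *
        ooDen (adjoinVar (Xt t n) (yvar n ^ t))) *
      (oo (parts (quo lam t (t * n + 1) i₀) (n + 1)) (adjoinVar (Xt t n) (yvar n ^ t)) *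
      ∏ i ∈ Finset.range i₀, schur (piParts lam t n i (n + n)) (XXt t n)) := by
  have hA : ∀ i ∈ Finset.range i₀, pairFactor (sepKernel t xvar (yvar n)) (sepRows n)
      (resClass (beta lam (t * n + 1)) t) t n i = resSign (RatFunField n) lam t n i *
        (pairConst n * schurDen (XXt t n)) * schur (piParts lam t n i (n + n)) (XXt t n) := by
    intro i hi
    rw [Finset.mem_range] at hi
    exact pairFactor_eq ht (by omega) (by rw [h.pair (by omega), if_neg (by omega), add_zero])
  rw [sortedDet, ldet_inner_middle_eq _ _ _ t n (length_sepRows n)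
    (sepKernel_eq_zero t xvar (yvar n) (beta lam (t * n + 1))) none i₀ hi₀
    (fun i hi => by rw [length_resClass_beta, length_resClass_beta, h.pair hi])
    (fun i hi => by rw [length_resClass_beta, h.mid hi])]
  simp only [length_resClass_beta]
  rw [resClass_beta, h.mid hi₀, if_pos rfl, ldet_midBlock_last _ hi₀ xvar_ne_zero (yvar_ne_zero n)]
  change _ * (_ * ooNum _ (adjoinVar (Xt t n) (yvar n ^ t))) = _
  rw [oo_mul_ooDen _ (ooDen_Xt_yvar_ne_zero ht), Finset.prod_mul_distrib,
    Finset.prod_congr rfl hA, Finset.prod_mul_distrib, Finset.prod_mul_distrib,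
    Finset.prod_const, Finset.card_range, neg_one_zpow_eps lam (by omega),
    show t / 2 = i₀ by omega]
  ring

/-- All characters are 1 and μ_0 = 0, so the bracket is y-1, and the sorting sign cancels the block
signs. -/
theorem sortedDet_bot (ht : 2 ≤ t) :
    (-1) ^ ((n + 1).choose 2 * t.choose 2) * sortedDet ⊥ t n =
      totalConst t n * (yvar n - 1) := by
  have ht0 : t ≠ 0 := by omega
  have hpi : ∀ i < t, ∀ N j, piParts ⊥ t n i N j = 0 := by
    intro i hi N j
    rw [piParts, glue, rowLen_quo_bot hi, rowLen_quo_bot (by omega), rowLen_quo_bot (by omega)]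
  have hmu : muExp ⊥ t n 0 = 0 := by
    rw [muExp, rowLen_quo_bot (by omega), resCount_bot (by omega), if_neg (by omega)]
    simp
  rw [sortedDet_of_ne ht0 (isMiddle_bot ht) (by omega), bracket, hmu,
    schur_zero (hpi 0 (by omega) _) (schurDen_XXt_yvar_ne_zero ht0),
    schur_zero (hpi 0 (by omega) _) (schurDen_XXt_yvar_inv_ne_zero ht0),
    Finset.prod_eq_one, neg_one_zpow_eps ⊥ (by omega), Finset.prod_range_zero, one_mul]
  · have hmid : (if Odd t then oo (parts (quo ⊥ t (t * n + 1) ((t - 1) / 2)) n) (Xt t n) else 1) =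
        1 := by
      split_ifs
      · exact oo_zero (fun j => rowLen_quo_bot (by omega) _) (ooDen_Xt_ne_zero ht0)
      · rfl
    rw [hmid, neg_zero, zero_add, zpow_one, zpow_zero]
    linear_combination (totalConst t n * (yvar n - 1)) *
      prod_resSign_bot (K := RatFunField n) (n := n) ht
  · intro i hi
    rw [Finset.mem_erase, Finset.mem_range] at hi
    exact schur_zero (hpi i (by omega) _) (schurDen_XXt_ne_zero ht0)

theorem isPrimitiveRoot_algebraMap (n : ℕ) {ω : ℂ} (hω : IsPrimitiveRoot ω t) :
    IsPrimitiveRoot (algebraMap ℂ (RatFunField n) ω) t :=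
  hω.map_of_injective (FaithfulSMul.algebraMap_injective ℂ (RatFunField n))

/-- The denominator is the numerator of the empty partition. Its columns are sorted with the
explicit sign of `ldet_beta_bot`, so no sign of a permutation is left over. -/
theorem ooDen_twisted (ht : 2 ≤ t) {ω : ℂ} (hω : IsPrimitiveRoot ω t) :
    ooDen (twisted t n ω) = (twistMatrix (algebraMap ℂ (RatFunField n) ω) t n).det *
      (totalConst t n * (yvar n - 1)) := by
  have hω' := isPrimitiveRoot_algebraMap n hω
  have e : ooDen (twisted t n ω) = (Matrix.of fun i j =>
      twistVars t (algebraMap ℂ (RatFunField n) ω) xvar (yvar n) i ^ (beta ⊥ (t * n + 1) j + 1) -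
      (twistVars t (algebraMap ℂ (RatFunField n) ω) xvar (yvar n) i)⁻¹ ^
        beta ⊥ (t * n + 1) j).det := by
    simp only [beta, rowLen_bot, zero_add]
    rfl
  obtain ⟨s, rfl⟩ := Nat.exists_eq_add_of_le' (show 1 ≤ t by omega)
  have hb := ldet_beta_bot (sepKernel (s + 1) xvar (yvar n))
    (inner (sepRows n) (s + 1) 0 ++ [none]) s n []
  rw [List.nil_append, List.nil_append] at hb
  have hc : inner (emptyClass (s + 1) n) (s + 1) 0 =
      inner (resClass (beta ⊥ ((s + 1) * n + 1)) (s + 1)) (s + 1) 0 := by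
    rw [inner, inner, List.flatMap_def, List.flatMap_def]
    congr 1
    apply List.map_congr_left
    intro i hi
    have hi' : i < s + 1 := by simpa using hi
    rw [resClass_beta, emptyClass, resCount_bot hi', partClass, partClass]
    simp only [rowLen_bot, rowLen_quo_bot hi']
  rw [e, twistMatrix_mul (by omega) hω'.pow_eq_one, Matrix.det_mul, ← ldet_ofFn, ofFn_allRows, hb, hc,
    ← sortedDet_bot ht]
  rfl

theorem ooNum_twisted (ht : 0 < t) {ω : ℂ} (hω : IsPrimitiveRoot ω t) (lam : YoungDiagram) :
    ooNum (parts lam (t * n + 1)) (twisted t n ω) =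
      (twistMatrix (algebraMap ℂ (RatFunField n) ω) t n).det *
      (((Equiv.Perm.sign (sortPerm lam t (t * n + 1)) : ℤ) : RatFunField n) * sortedDet lam t n) :=
  det_odd_eq_ldet ht (isPrimitiveRoot_algebraMap n hω).pow_eq_one xvar (yvar n)
    (beta_strictAnti lam (t * n + 1))

theorem oo_twisted (ht : 2 ≤ t) {ω : ℂ} (hω : IsPrimitiveRoot ω t) (lam : YoungDiagram) :
    oo (parts lam (t * n + 1)) (twisted t n ω) =
      ((Equiv.Perm.sign (sortPerm lam t (t * n + 1)) : ℤ) : RatFunField n) *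
        (sortedDet lam t n / (totalConst t n * (yvar n - 1))) := by
  have hW := det_twistMatrix_ne_zero n (show 0 < t by omega) (isPrimitiveRoot_algebraMap n hω)
  have : oo (parts lam (t * n + 1)) (twisted t n ω) =
    ooNum (parts lam (t * n + 1)) (twisted t n ω) / ooDen (twisted t n ω) := rfl
  rw [this, ooNum_twisted (by omega) hω, ooDen_twisted ht hω, mul_div_mul_left _ _ hW, mul_div_assoc]

theorem oo_twisted_eq_zero (ht : 2 ≤ t) {ω : ℂ} (hω : IsPrimitiveRoot ω t) (lam : YoungDiagram)
    {i : ℕ} (hi : i < t)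
    (h : resCount lam t (t * n + 1) i + resCount lam t (t * n + 1) (t - 1 - i) < 2 * n) :
    oo (parts lam (t * n + 1)) (twisted t n ω) = 0 := by
  have e : ooNum (parts lam (t * n + 1)) (twisted t n ω) = (Matrix.of fun i j =>
      twistVars t (algebraMap ℂ (RatFunField n) ω) xvar (yvar n) i ^ (beta lam (t * n + 1) j + 1) -
      (twistVars t (algebraMap ℂ (RatFunField n) ω) xvar (yvar n) i)⁻¹ ^
        beta lam (t * n + 1) j).det := rfl
  rw [twistMatrix_mul (by omega) (isPrimitiveRoot_algebraMap n hω).pow_eq_one, Matrix.det_mul,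
    det_sepKernel_eq_zero _ _ lam hi h, mul_zero] at e
  have : oo (parts lam (t * n + 1)) (twisted t n ω) =
    ooNum (parts lam (t * n + 1)) (twisted t n ω) / ooDen (twisted t n ω) := rfl
  rw [this, e, zero_div]

theorem oo_one_var (m n : ℕ) :
    oo ![m] ![yvar n] = (yvar n ^ (m + 1) - (yvar n)⁻¹ ^ m) / (yvar n - 1) := by
  simp [oo]

theorem oo_twisted_of_ne (ht : 2 ≤ t) {ω : ℂ} (hω : IsPrimitiveRoot ω t) {lam : YoungDiagram}
    {i₀ : ℕ} (h : IsMiddle lam t n i₀) (hi₀ : 2 * i₀ + 1 ≠ t) :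
    oo (parts lam (t * n + 1)) (twisted t n ω) =
      ((Equiv.Perm.sign (sortPerm lam t (t * n + 1)) : ℤ) : RatFunField n) *
      (-1) ^ eps lam t n i₀ * (bracket lam t n i₀ / (yvar n - 1)) *
      (∏ i ∈ (Finset.range (t / 2)).erase i₀, schur (piParts lam t n i (n + n)) (XXt t n)) *
      (if Odd t then oo (parts (quo lam t (t * n + 1) ((t - 1) / 2)) n) (Xt t n) else 1) := by
  have hlt : 2 * i₀ + 1 < t := by
    have := h.1
    omega
  have h1 : totalConst t n ≠ 0 := totalConst_ne_zero (by omega)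
  have h2 := yvar_sub_one_ne_zero n
  rw [oo_twisted ht hω, sortedDet_of_ne (by omega) h hlt]
  generalize (if Odd t then oo (parts (quo lam t (t * n + 1) ((t - 1) / 2)) n) (Xt t n) else 1) = m
  field_simp

theorem oo_twisted_of_eq (ht : 2 ≤ t) {ω : ℂ} (hω : IsPrimitiveRoot ω t) {lam : YoungDiagram}
    {i₀ : ℕ} (h : IsMiddle lam t n i₀) (hi₀ : 2 * i₀ + 1 = t) :
    oo (parts lam (t * n + 1)) (twisted t n ω) =
      (-1) ^ eps lam t n i₀ *
      ((Equiv.Perm.sign (sortPerm lam t (t * n + 1)) : ℤ) : RatFunField n) *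
      oo ![(t - 1) / 2] ![yvar n] *
      oo (parts (quo lam t (t * n + 1) ((t - 1) / 2)) (n + 1)) (adjoinVar (Xt t n) (yvar n ^ t)) *
      ∏ i ∈ Finset.range ((t - 1) / 2), schur (piParts lam t n i (n + n)) (XXt t n) := by
  have ht0 : t ≠ 0 := by omega
  have hodd : Odd t := ⟨i₀, hi₀.symm⟩
  have h2 := yvar_sub_one_ne_zero n
  have hy := yvar_ne_zero n
  rw [oo_twisted ht hω, sortedDet_of_eq ht0 h hi₀, oo_one_var, show (t - 1) / 2 = i₀ by omega]
  generalize (-1 : RatFunField n) ^ eps lam t n i₀ = E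
  generalize ((Equiv.Perm.sign (sortPerm lam t (t * n + 1)) : ℤ) : RatFunField n) = σ
  generalize oo (parts (quo lam t (t * n + 1) i₀) (n + 1)) (adjoinVar (Xt t n) (yvar n ^ t)) = o
  generalize ∏ i ∈ Finset.range i₀, schur (piParts lam t n i (n + n)) (XXt t n) = s
  -- The surplus column is in the middle block for λ but in the pair of 0 for the denominator.
  -- Trading one denominator for the other leaves y^(-i₀)(y^t - 1) = y^(i₀+1) - y^(-i₀), the
  -- numerator of the one-variable character.
  have key : (pairConst n * schurDen (XXt t n)) ^ i₀ * ((∏ b : Fin n, (xvar b)⁻¹ ^ i₀) *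
      (yvar n)⁻¹ ^ i₀ * ooDen (adjoinVar (Xt t n) (yvar n ^ t))) =
      totalConst t n * (yvar n ^ (i₀ + 1) - (yvar n)⁻¹ ^ i₀) := by
    have h3 := ooDen_Xt_yvar_mul t n
    have h4 : (yvar n) ^ t * (yvar n)⁻¹ ^ i₀ = yvar n ^ (i₀ + 1) := by
      rw [← hi₀, show 2 * i₀ + 1 = i₀ + 1 + i₀ by ring, pow_add _ (i₀ + 1), inv_pow]
      field_simp
    have h5 : (-1 : RatFunField n) ^ (t * n) = (-1) ^ n := by
      rw [pow_mul, hodd.neg_one_pow]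
    have h6 : yvar n ^ (t * n) ≠ 0 := pow_ne_zero _ hy
    -- Here i₀ ≥ 1, because 2i₀+1 = t ≥ 2.
    have h7 : (pairConst n * schurDen (XXt t n)) ^ i₀ =
        (pairConst n * schurDen (XXt t n)) ^ (i₀ - 1) * (pairConst n * schurDen (XXt t n)) := by
      rw [← pow_succ, show i₀ - 1 + 1 = i₀ by omega]
    rw [totalConst, midConst, if_pos hodd, h5, show t / 2 = i₀ by omega, h7, ← h4]
    rw [← mul_left_inj' h6]
    generalize (pairConst n * schurDen (XXt t n)) ^ (i₀ - 1) = Q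
    generalize (∏ b : Fin n, (xvar b)⁻¹ ^ i₀) = R
    have h8 : (yvar n ^ (t * n))⁻¹ * yvar n ^ (t * n) = 1 := inv_mul_cancel₀ h6
    linear_combination Q * pairConst n * R * (yvar n)⁻¹ ^ i₀ * h3 -
      (-1) ^ n * pairConst n * Q * schurDen (adjoinVar (XXt t n) (yvar n ^ t)) * R *
        ooDen (Xt t n) * (yvar n ^ t * (yvar n)⁻¹ ^ i₀ - (yvar n)⁻¹ ^ i₀) * h8
  rw [mul_assoc E, key]
  have h1 : totalConst t n ≠ 0 := totalConst_ne_zero ht0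
  field_simp

end Assembly

end OddOrthFactor

/-! ### The factorization theorem -/

theorem mainTheorem2 (t n : ℕ) (ht : 2 ≤ t) (hn : 0 < n) (ω : ℂ) (hω : IsPrimitiveRoot ω t)
    (lam : YoungDiagram) (hlam : lam.colLen 0 ≤ t * n + 1) :
    ((∃ k, IsAsymmetric 2 0 k (core lam t (t * n + 1)) ∨
        IsAsymmetric 2 1 k (core lam t (t * n + 1))) →
      (∃! i₀, IsMiddle lam t n i₀) ∧
      ∀ i₀, IsMiddle lam t n i₀ →
        (2 * i₀ + 1 = t →
          oo (parts lam (t * n + 1)) (twisted t n ω) =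
            (-1) ^ eps lam t n i₀ *
            ((Equiv.Perm.sign (sortPerm lam t (t * n + 1)) : ℤ) : RatFunField n) *
            oo ![(t - 1) / 2] ![yvar n] *
            oo (parts (quo lam t (t * n + 1) ((t - 1) / 2)) (n + 1))
              (adjoinVar (Xt t n) (yvar n ^ t)) *
            ∏ i ∈ Finset.range ((t - 1) / 2), schur (piParts lam t n i (n + n)) (XXt t n)) ∧
        (2 * i₀ + 1 ≠ t →
          oo (parts lam (t * n + 1)) (twisted t n ω) =
            ((Equiv.Perm.sign (sortPerm lam t (t * n + 1)) : ℤ) : RatFunField n) *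
            (-1) ^ eps lam t n i₀ *
            ((yvar n ^ (-muExp lam t n i₀ + 1) *
                schur (piParts lam t n i₀ (n + n + 1)) (adjoinVar (XXt t n) (yvar n ^ t)) -
              yvar n ^ muExp lam t n i₀ *
                schur (piParts lam t n i₀ (n + n + 1)) (adjoinVar (XXt t n) ((yvar n)⁻¹ ^ t))) /
              (yvar n - 1)) *
            (∏ i ∈ (Finset.range (t / 2)).erase i₀,
              schur (piParts lam t n i (n + n)) (XXt t n)) *
            (if Odd t then oo (parts (quo lam t (t * n + 1) ((t - 1) / 2)) n) (Xt t n) else 1))) ∧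
    ((¬ ∃ k, IsAsymmetric 2 0 k (core lam t (t * n + 1)) ∨
        IsAsymmetric 2 1 k (core lam t (t * n + 1))) →
      oo (parts lam (t * n + 1)) (twisted t n ω) = 0) := by
  have ht0 : 0 < t := by omega
  -- Once asymmetry is a condition on residue counts, its negation is exactly a deficient pair,
  -- which forces the character to vanish.
  rw [exists_isAsymmetric_core_iff lam ht0 n]
  refine ⟨fun h => ⟨?_, fun i₀ hi₀ => ⟨oo_twisted_of_eq ht hω hi₀, oo_twisted_of_ne ht hω hi₀⟩⟩,
    fun h => ?_⟩
  · obtain ⟨i₀, hi₀⟩ := exists_isMiddle ht0 h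
    exact ⟨i₀, hi₀, fun i₁ hi₁ => hi₁.eq hi₀⟩
  · push Not at h
    obtain ⟨i, hi, hlt⟩ := h
    exact oo_twisted_eq_zero ht hω lam hi hlt
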